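/- Let $d\in\{2,3\}$, let $H$ be the space of zero mean, divergence-free vector fields in $L^2(\mathbb T^d,\mathbb R^d)$, let $A$ be the Stokes operator on $H$, and for $s\in\mathbb R$ let $H^s=\mathrm{Dom}((-A)^{s/2})\subseteq H$ with norm $\|v\|_{H^s}=\|(-A)^{s/2}v\|_{L^2}$. Fix $\xi>\frac d2+2$, $T>0$ and $\mathcal H\in(\frac12,1)$. Let $(e_k)_{k\ge1}\subset H^\xi$ be orthonormal in $H$ and orthogonal in $H^\xi$, and let $\sigma_k\ge0$ with $\sum_k\sigma_k^2\|e_k\|_{H^\xi}^2<\infty$. On a probability space $(\Omega,\mathcal F,\mathbb P)$ let $(W^{\mathcal H,k})_{k\ge1}$ be independent real fractional Brownian motions with Hurst parameter $\mathcal H$, and put $W^{\mathcal H}_t=\sum_k\sigma_ke_kW^{\mathcal H,k}_t$. Let $C:D(C)\subseteq H\to H$ be linear, densely defined and closed, with $0\in\rho(C)$, such that $Ce_k=\lambda_ke_k$ for all $k$, $\sup_k\lambda_k=\lambda_1<0$, and, for some $\gamma\ge0$ and $c>0$, $-\langle x,Cx\rangle\ge c\|x\|_{H^\gamma}^2$ for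 all $x\in D(C)$ (in particular $D(C)\subseteq H^\gamma$). For $\epsilon\in(0,1)$ let $w^\epsilon$ be the solution, with continuous paths in $H^\xi$, of $$dw^\epsilon_t=\epsilon^{-1}Cw^\epsilon_t\,dt+\epsilon^{-\mathcal H}dW^{\mathcal H}_t,\qquad w^\epsilon_0=0,\qquad t\in[0,T],$$ that is, $\int_0^tw^\epsilon_r\,dr\in D(C)$ and $w^\epsilon_t=\epsilon^{-1}C\int_0^tw^\epsilon_r\,dr+\epsilon^{-\mathcal H}W^{\mathcal H}_t$ for all $t\in[0,T]$, almost surely. With $\alpha=1$ put $y^\epsilon_t=\int_0^t\epsilon^{-\alpha+\mathcal H}w^\epsilon_r\,dr$. Let $\|f\|_{p\text{-var}}=\sup\big(\sum_i\|f(t_{i+1})-f(t_i)\|_{H^\xi}^p\big)^{1/p}$, the supremum being over the partitions of $[0,T]$, and let $C^{p\text{-var}}(H^\xi)$ be the closure of the smooth paths $[0,T]\to H^\xi$ for this seminorm. Then for every $p>1/\mathcal H$ and every $q\in[2,\infty)$ the following hold. 1. Solutions $w^\epsilon$ exist, and can be chosen so that, outside a single null set, the equation holds for all $\epsilon\in(0,1)$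 simultaneously. 2. For every choice of solutions $w^\epsilon$, $y^\epsilon\in L^q(\Omega;C^{p\text{-var}}(H^\xi))$ for all $\epsilon\in(0,1)$; the process $(-C)^{-1}W^{\mathcal H}$ takes values in $H^\xi$, belongs to $L^q(\Omega;C^{p\text{-var}}(H^\xi))$, and $$y^\epsilon\to(-C)^{-1}W^{\mathcal H}\quad\text{in }L^q(\Omega;C^{p\text{-var}}(H^\xi))\text{ as }\epsilon\downarrow0.$$ 3. For every choice of solutions, the map $\epsilon\in(0,1)\mapsto y^\epsilon\in L^q(\Omega;C^{p\text{-var}}(H^\xi))$ is Hölder continuous: there are $\theta\in(0,1]$ and $K<\infty$ with $\mathbb E\big[\|y^\epsilon-y^\delta\|_{p\text{-var}}^q\big]^{1/q}\le K|\epsilon-\delta|^\theta$ for all $\epsilon,\delta\in(0,1)$. 4. If the equation for $w^\epsilon$ holds for all $\epsilon\in(0,1)$ simultaneously outside a single null set, then $\sup_{\epsilon\in(0,1)}\|y^\epsilon\|^q_{p\text{-var}}$ is measurable up to null sets and $$\mathbb E\Big[\sup_{\epsilon\in(0,1)}\|y^\epsilon\|_{p\text{-var}}^q\Big]<\infty.$$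 -/

import Mathlib

open MeasureTheory ProbabilityTheory Filter Topology Set
open scoped ENNReal NNReal

noncomputable section

namespace FastSlow

/-! ### Divergence-free vector fields on the torus and the Sobolev scale -/

/-- The `d`-dimensional torus `ℝ^d / ℤ^d`. -/
abbrev Torus (d : ℕ) : Type := UnitAddTorus (Fin d)

/-- The normalised Lebesgue (Haar) measure on the torus. -/
abbrev torusMeasure (d : ℕ) : Measure (Torus d) :=
  Measure.pi fun _ => (AddCircle.haarAddCircle : Measure UnitAddCircle)

/-- The space `L²(𝕋^d, ℝ^d)` of square integrable vector fields. -/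
abbrev VectorField (d : ℕ) : Type := Lp (EuclideanSpace ℝ (Fin d)) 2 (torusMeasure d)

/-- The `n`-th Fourier coefficient of the `j`-th component of a vector field. -/
def fourierCoeff {d : ℕ} (v : VectorField d) (n : Fin d → ℤ) (j : Fin d) : ℂ :=
  ∫ x, UnitAddTorus.mFourier (-n) x * ((v x j : ℝ) : ℂ) ∂(torusMeasure d)

/-- The `j`-th component of a vector field, seen as an element of the complex `L²` space. -/
def component (d : ℕ) (j : Fin d) : VectorField d →L[ℝ] Lp ℂ 2 (torusMeasure d) :=
  ContinuousLinearMap.compLpL 2 (torusMeasure d)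
    (Complex.ofRealCLM.comp (EuclideanSpace.proj j : EuclideanSpace ℝ (Fin d) →L[ℝ] ℝ))

theorem fourierCoeff_eq {d : ℕ} (v : VectorField d) (n : Fin d → ℤ) (j : Fin d) :
    fourierCoeff v n j = UnitAddTorus.mFourierBasis.repr (component d j v) n := by
  rw [UnitAddTorus.mFourierBasis_repr]
  refine integral_congr_ae ?_
  have h := ContinuousLinearMap.coeFn_compLpL (p := 2) (μ := torusMeasure d)
    (Complex.ofRealCLM.comp (EuclideanSpace.proj j : EuclideanSpace ℝ (Fin d) →L[ℝ] ℝ)) v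
  filter_upwards [h] with x hx
  simp only [component, smul_eq_mul]
  erw [hx]
  rfl

theorem fourierCoeff_add {d : ℕ} (u v : VectorField d) (n : Fin d → ℤ) (j : Fin d) :
    fourierCoeff (u + v) n j = fourierCoeff u n j + fourierCoeff v n j := by
  simp only [fourierCoeff_eq, map_add]
  rfl

theorem fourierCoeff_smul {d : ℕ} (a : ℝ) (v : VectorField d) (n : Fin d → ℤ) (j : Fin d) :
    fourierCoeff (a • v) n j = a * fourierCoeff v n j := by
  have h : component d j (a • v) = (a : ℂ) • component d j v := by
    rw [map_smul]
    rfl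
  rw [fourierCoeff_eq, fourierCoeff_eq, h, map_smul]
  rfl

theorem fourierCoeff_zero {d : ℕ} (n : Fin d → ℤ) (j : Fin d) :
    fourierCoeff (0 : VectorField d) n j = 0 := by
  simp [fourierCoeff_eq]

theorem continuous_fourierCoeff {d : ℕ} (n : Fin d → ℤ) (j : Fin d) :
    Continuous fun v : VectorField d => fourierCoeff v n j := by
  simp only [fourierCoeff_eq]
  have h : Continuous fun f : Lp ℂ 2 (torusMeasure d) =>
      UnitAddTorus.mFourierBasis.repr f n := by
    simp only [HilbertBasis.repr_apply_apply]
    fun_prop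
  exact h.comp (component d j).continuous

/-- A vector field is determined by its Fourier coefficients. -/
theorem eq_of_fourierCoeff_eq {d : ℕ} {u v : VectorField d}
    (h : ∀ n j, fourierCoeff u n j = fourierCoeff v n j) : u = v := by
  have hc : ∀ j, component d j u = component d j v := by
    intro j
    apply UnitAddTorus.mFourierBasis.repr.injective
    ext n
    simpa only [fourierCoeff_eq] using h n j
  have key : ∀ j, ∀ᵐ x ∂(torusMeasure d), u x j = v x j := by
    intro j
    have hu := ContinuousLinearMap.coeFn_compLpL (p := 2) (μ := torusMeasure d)
      (Complex.ofRealCLM.comp (EuclideanSpace.proj j : EuclideanSpace ℝ (Fin d) →L[ℝ] ℝ)) u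
    have hv := ContinuousLinearMap.coeFn_compLpL (p := 2) (μ := torusMeasure d)
      (Complex.ofRealCLM.comp (EuclideanSpace.proj j : EuclideanSpace ℝ (Fin d) →L[ℝ] ℝ)) v
    have hj := hc j
    simp only [component] at hj
    filter_upwards [hu, hv] with x hx hy
    rw [hj] at hx
    have := hx.symm.trans hy
    simpa using this
  refine Lp.ext ?_
  filter_upwards [ae_all_iff.2 key] with x hx
  ext j
  exact hx j

/-- The space of zero mean, divergence-free vector fields in `L²(𝕋^d, ℝ^d)`: the zeroth Fourier
coefficient vanishes, and `∑ⱼ nⱼ v̂ⱼ(n) = 0` for all `n`. -/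
def solenoidal (d : ℕ) : Submodule ℝ (VectorField d) where
  carrier := {v | (∀ j, fourierCoeff v 0 j = 0) ∧
    ∀ n : Fin d → ℤ, ∑ j, (n j : ℂ) * fourierCoeff v n j = 0}
  add_mem' := by
    rintro u v ⟨hu, hu'⟩ ⟨hv, hv'⟩
    refine ⟨fun j => by simp [fourierCoeff_add, hu j, hv j], fun n => ?_⟩
    simp [fourierCoeff_add, mul_add, Finset.sum_add_distrib, hu' n, hv' n]
  zero_mem' := ⟨fun j => fourierCoeff_zero _ _, fun n => by simp [fourierCoeff_zero]⟩
  smul_mem' := by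
    rintro a v ⟨hv, hv'⟩
    refine ⟨fun j => by simp [fourierCoeff_smul, hv j], fun n => ?_⟩
    have : ∑ j, (n j : ℂ) * fourierCoeff (a • v) n j
        = a * ∑ j, (n j : ℂ) * fourierCoeff v n j := by
      rw [Finset.mul_sum]
      exact Finset.sum_congr rfl fun j _ => by rw [fourierCoeff_smul]; ring
    rw [this, hv' n, mul_zero]

/-- The Hilbert space `H` of zero mean, divergence-free vector fields, with the `L²` inner
product. -/
abbrev HSpace (d : ℕ) : Type := solenoidal d

instance (d : ℕ) : CompleteSpace (HSpace d) := by
  have : IsClosed (solenoidal d : Set (VectorField d)) := by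
    have h : (solenoidal d : Set (VectorField d)) =
        (⋂ j, {v | fourierCoeff v 0 j = 0}) ∩
        ⋂ n : Fin d → ℤ, {v | ∑ j, (n j : ℂ) * fourierCoeff v n j = 0} := by
      ext v
      simp [solenoidal]
    rw [h]
    refine (isClosed_iInter fun j => ?_).inter (isClosed_iInter fun n => ?_)
    · exact isClosed_eq (continuous_fourierCoeff _ _) continuous_const
    · exact isClosed_eq (continuous_finsetSum _ fun j _ =>
        continuous_const.mul (continuous_fourierCoeff _ _)) continuous_const
  exact this.completeSpace_coe

/-- `|2πn|`, whose square is the eigenvalue of the Stokes operator `-A` at frequency `n`. -/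
def freqNorm {d : ℕ} (n : Fin d → ℤ) : ℝ :=
  2 * Real.pi * Real.sqrt (∑ j, (n j : ℝ) ^ 2)

theorem freqNorm_pos {d : ℕ} {n : Fin d → ℤ} (hn : n ≠ 0) : 0 < freqNorm n := by
  obtain ⟨j, hj⟩ := Function.ne_iff.1 hn
  have hj' : (n j : ℝ) ≠ 0 := by exact_mod_cast hj
  have : 0 < ∑ j, (n j : ℝ) ^ 2 :=
    Finset.sum_pos' (fun i _ => sq_nonneg _) ⟨j, Finset.mem_univ j, by positivity⟩
  unfold freqNorm
  positivity

/-- `IsStokesPow s v g` says that `v` lies in the domain of `(-A)^{s/2}` and that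
`(-A)^{s/2} v = g`; the operator is the Fourier multiplier with symbol `|2πn|^s`. -/
def IsStokesPow {d : ℕ} (s : ℝ) (v g : HSpace d) : Prop :=
  ∀ n j, fourierCoeff (g : VectorField d) n j
    = ((freqNorm n ^ s : ℝ) : ℂ) * fourierCoeff (v : VectorField d) n j

theorem IsStokesPow.unique {d : ℕ} {s : ℝ} {v g g' : HSpace d}
    (h : IsStokesPow s v g) (h' : IsStokesPow s v g') : g = g' :=
  Subtype.ext (eq_of_fourierCoeff_eq fun n j => by rw [h n j, h' n j])

/-- The domain of `(-A)^{s/2}`, as a subspace of `H`. -/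
def sobolevDomain (d : ℕ) (s : ℝ) : Submodule ℝ (HSpace d) where
  carrier := {v | ∃ g, IsStokesPow s v g}
  add_mem' := by
    rintro u v ⟨f, hf⟩ ⟨g, hg⟩
    refine ⟨f + g, fun n j => ?_⟩
    simp [fourierCoeff_add, hf n j, hg n j, mul_add]
  zero_mem' := ⟨0, fun n j => by simp [fourierCoeff_zero]⟩
  smul_mem' := by
    rintro a v ⟨g, hg⟩
    refine ⟨a • g, fun n j => ?_⟩
    simp only [Submodule.coe_smul, fourierCoeff_smul, hg n j]
    ring

/-- The Sobolev space `H^s = Dom((-A)^{s/2})`. It is a separate type, since it does not carry the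
norm of `H` but `‖v‖_{H^s} = ‖(-A)^{s/2} v‖_{L²}`. -/
def Sobolev (d : ℕ) (s : ℝ) : Type := sobolevDomain d s

instance (d : ℕ) (s : ℝ) : AddCommGroup (Sobolev d s) :=
  inferInstanceAs (AddCommGroup (sobolevDomain d s))

instance (d : ℕ) (s : ℝ) : Module ℝ (Sobolev d s) :=
  inferInstanceAs (Module ℝ (sobolevDomain d s))

/-- The inclusion of `H^s` into `H`. -/
def Sobolev.incl {d : ℕ} {s : ℝ} : Sobolev d s →ₗ[ℝ] HSpace d := (sobolevDomain d s).subtype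

theorem Sobolev.incl_injective {d : ℕ} {s : ℝ} :
    Function.Injective (Sobolev.incl : Sobolev d s →ₗ[ℝ] HSpace d) :=
  Subtype.val_injective

theorem Sobolev.exists_stokesPow {d : ℕ} {s : ℝ} (v : Sobolev d s) :
    ∃ g, IsStokesPow s (Sobolev.incl v) g := v.2

/-- The operator `(-A)^{s/2} : H^s → H`. -/
def stokesPow (d : ℕ) (s : ℝ) : Sobolev d s →ₗ[ℝ] HSpace d where
  toFun v := (Sobolev.exists_stokesPow v).choose
  map_add' u v := by
    refine (Sobolev.exists_stokesPow (u + v)).choose_spec.unique fun n j => ?_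
    have hu := (Sobolev.exists_stokesPow u).choose_spec n j
    have hv := (Sobolev.exists_stokesPow v).choose_spec n j
    simp only [map_add, Submodule.coe_add, fourierCoeff_add, hu, hv, mul_add]
  map_smul' a v := by
    refine (Sobolev.exists_stokesPow (a • v)).choose_spec.unique fun n j => ?_
    have hv := (Sobolev.exists_stokesPow v).choose_spec n j
    simp only [RingHom.id_apply, map_smul, Submodule.coe_smul, fourierCoeff_smul, hv]
    ring

theorem isStokesPow_stokesPow {d : ℕ} {s : ℝ} (v : Sobolev d s) :
    IsStokesPow s (Sobolev.incl v) (stokesPow d s v) :=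
  (Sobolev.exists_stokesPow v).choose_spec

theorem stokesPow_injective (d : ℕ) (s : ℝ) : Function.Injective (stokesPow d s) := by
  intro u v huv
  apply Sobolev.incl_injective
  refine Subtype.ext (eq_of_fourierCoeff_eq fun n j => ?_)
  by_cases hn : n = 0
  · subst hn
    rw [(Sobolev.incl u).2.1 j, (Sobolev.incl v).2.1 j]
  · have h := (isStokesPow_stokesPow u n j).symm.trans
      ((congrArg (fun g : HSpace d => fourierCoeff (g : VectorField d) n j) huv).trans
        (isStokesPow_stokesPow v n j))
    have hpos : ((freqNorm n ^ s : ℝ) : ℂ) ≠ 0 := by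
      exact_mod_cast (Real.rpow_pos_of_pos (freqNorm_pos hn) s).ne'
    exact mul_left_cancel₀ hpos h

instance (d : ℕ) (s : ℝ) : NormedAddCommGroup (Sobolev d s) :=
  NormedAddCommGroup.induced (Sobolev d s) (HSpace d) (stokesPow d s) (stokesPow_injective d s)

theorem Sobolev.norm_def {d : ℕ} {s : ℝ} (v : Sobolev d s) : ‖v‖ = ‖stokesPow d s v‖ := rfl

/-- The inner product of `H^s` is `⟨(-A)^{s/2} u, (-A)^{s/2} v⟩`. -/
instance (d : ℕ) (s : ℝ) : InnerProductSpace ℝ (Sobolev d s) where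
  inner u v := inner ℝ (stokesPow d s u) (stokesPow d s v)
  norm_smul_le a v := by
    rw [Sobolev.norm_def, Sobolev.norm_def, map_smul]
    exact norm_smul_le _ _
  norm_sq_eq_re_inner v := norm_sq_eq_re_inner (𝕜 := ℝ) (stokesPow d s v)
  conj_inner_symm u v := inner_conj_symm _ _
  add_left u v w := by rw [map_add, inner_add_left]
  smul_left u v a := by rw [map_smul]; exact real_inner_smul_left (stokesPow d s u) (stokesPow d s v) a

theorem one_le_freqNorm {d : ℕ} {n : Fin d → ℤ} (hn : n ≠ 0) : 1 ≤ freqNorm n := by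
  obtain ⟨j, hj⟩ := Function.ne_iff.1 hn
  have hj1 : (1 : ℝ) ≤ (n j : ℝ) ^ 2 := by
    have : 0 < (n j) ^ 2 := by
      have : n j ≠ 0 := hj
      positivity
    exact_mod_cast this
  have h1 : (1 : ℝ) ≤ ∑ j, (n j : ℝ) ^ 2 :=
    hj1.trans (Finset.single_le_sum (f := fun j => (n j : ℝ) ^ 2)
      (fun i _ => sq_nonneg _) (Finset.mem_univ j))
  have h2 : 1 ≤ Real.sqrt (∑ j, (n j : ℝ) ^ 2) := Real.one_le_sqrt.2 h1
  unfold freqNorm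
  nlinarith [Real.pi_gt_three]

theorem norm_component_incl_le {d : ℕ} {s : ℝ} (hs : 0 ≤ s) (v : Sobolev d s) (j : Fin d) :
    ‖component d j (Sobolev.incl v : VectorField d)‖
      ≤ ‖component d j (stokesPow d s v : VectorField d)‖ := by
  rw [← UnitAddTorus.mFourierBasis.repr.norm_map (component d j (Sobolev.incl v : VectorField d)),
    ← UnitAddTorus.mFourierBasis.repr.norm_map (component d j (stokesPow d s v : VectorField d))]
  refine lp.norm_le_of_forall_sum_le (by norm_num) (norm_nonneg _) fun S => ?_
  refine le_trans (Finset.sum_le_sum fun n _ => ?_)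
    (lp.sum_rpow_le_norm_rpow (by norm_num) _ S)
  refine Real.rpow_le_rpow (norm_nonneg _) ?_ (by norm_num)
  rw [← fourierCoeff_eq, ← fourierCoeff_eq, isStokesPow_stokesPow v n j, norm_mul]
  by_cases hn : n = 0
  · subst hn
    rw [(Sobolev.incl v).2.1 j]
    simp
  · have h1 : 1 ≤ freqNorm n ^ s := Real.one_le_rpow (one_le_freqNorm hn) hs
    refine le_mul_of_one_le_left (norm_nonneg _) ?_
    rw [Complex.norm_real, Real.norm_eq_abs]
    exact h1.trans (le_abs_self _)

/-- The inclusion of `H^s` into `H` is bounded when `0 ≤ s`. -/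
theorem exists_norm_incl_le (d : ℕ) {s : ℝ} (hs : 0 ≤ s) :
    ∃ K : ℝ, ∀ v : Sobolev d s, ‖Sobolev.incl v‖ ≤ K * ‖v‖ := by
  let L : Fin d → Lp ℂ 2 (torusMeasure d) →L[ℝ] VectorField d := fun j =>
    ContinuousLinearMap.compLpL 2 (torusMeasure d)
      ((ContinuousLinearMap.toSpanSingleton ℝ
        (EuclideanSpace.single j (1 : ℝ) : EuclideanSpace ℝ (Fin d))).comp Complex.reCLM)
  have hL : ∀ v : VectorField d, v = ∑ j, L j (component d j v) := by
    intro v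
    refine Lp.ext ?_
    have h1 := Lp.coeFn_finsetSum Finset.univ (fun j => L j (component d j v))
    have h2 : ∀ᵐ x ∂(torusMeasure d), ∀ j, L j (component d j v) x
        = ((component d j v x).re) • (EuclideanSpace.single j (1 : ℝ)) := by
      refine ae_all_iff.2 fun j => ?_
      filter_upwards [ContinuousLinearMap.coeFn_compLpL (p := 2) (μ := torusMeasure d)
        ((ContinuousLinearMap.toSpanSingleton ℝ
        (EuclideanSpace.single j (1 : ℝ) : EuclideanSpace ℝ (Fin d))).comp Complex.reCLM)
          (component d j v)] with x hx
      simpa [L] using hx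
    have h3 : ∀ᵐ x ∂(torusMeasure d), ∀ j, component d j v x = ((v x j : ℝ) : ℂ) := by
      refine ae_all_iff.2 fun j => ?_
      filter_upwards [ContinuousLinearMap.coeFn_compLpL (p := 2) (μ := torusMeasure d)
        (Complex.ofRealCLM.comp (EuclideanSpace.proj j : EuclideanSpace ℝ (Fin d) →L[ℝ] ℝ)) v]
        with x hx
      simpa [component] using hx
    filter_upwards [h1, h2, h3] with x hx1 hx2 hx3
    rw [hx1]
    ext i
    simp [hx2, hx3, Finset.sum_apply, Pi.single_apply]
  refine ⟨∑ j, ‖L j‖ * ‖component d j‖, fun v => ?_⟩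
  calc ‖Sobolev.incl v‖ = ‖∑ j, L j (component d j (Sobolev.incl v : VectorField d))‖ := by
        rw [← hL]; rfl
    _ ≤ ∑ j, ‖L j‖ * ‖component d j‖ * ‖v‖ := by
        refine (norm_sum_le _ _).trans (Finset.sum_le_sum fun j _ => ?_)
        refine ((L j).le_opNorm _).trans ?_
        rw [mul_assoc]
        refine mul_le_mul_of_nonneg_left ?_ (norm_nonneg _)
        exact (norm_component_incl_le hs v j).trans ((component d j).le_opNorm _)
    _ = _ := by rw [Finset.sum_mul]

/-- The space `H^s` is complete when `0 ≤ s`. -/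
theorem Sobolev.completeSpace (d : ℕ) {s : ℝ} (hs : 0 ≤ s) : CompleteSpace (Sobolev d s) := by
  obtain ⟨K, hK⟩ := exists_norm_incl_le d hs
  refine Metric.complete_of_cauchySeq_tendsto fun u hu => ?_
  have hi : LipschitzWith 1 (stokesPow d s) :=
    LipschitzWith.of_dist_le_mul fun x y => by
      rw [dist_eq_norm, dist_eq_norm, ← map_sub, ← Sobolev.norm_def]; simp
  have hj : LipschitzWith K.toNNReal (Sobolev.incl : Sobolev d s →ₗ[ℝ] HSpace d) :=
    LipschitzWith.of_dist_le_mul fun x y => by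
      rw [dist_eq_norm, dist_eq_norm, ← map_sub]
      exact (hK _).trans (mul_le_mul_of_nonneg_right (Real.le_coe_toNNReal K) (norm_nonneg _))
  obtain ⟨g, hg⟩ := cauchySeq_tendsto_of_complete (hi.uniformContinuous.comp_cauchySeq hu)
  obtain ⟨v, hv⟩ := cauchySeq_tendsto_of_complete (hj.uniformContinuous.comp_cauchySeq hu)
  have hvg : IsStokesPow s v g := by
    intro n j
    have h1 : Tendsto (fun k => fourierCoeff (stokesPow d s (u k) : VectorField d) n j) atTop
        (𝓝 (fourierCoeff (g : VectorField d) n j)) :=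
      (((continuous_fourierCoeff n j).comp continuous_subtype_val).tendsto g).comp hg
    have h2 : Tendsto (fun k => fourierCoeff (Sobolev.incl (u k) : VectorField d) n j) atTop
        (𝓝 (fourierCoeff (v : VectorField d) n j)) :=
      (((continuous_fourierCoeff n j).comp continuous_subtype_val).tendsto v).comp hv
    refine tendsto_nhds_unique h1 ?_
    have h3 := h2.const_mul ((freqNorm n ^ s : ℝ) : ℂ)
    refine h3.congr fun k => (isStokesPow_stokesPow (u k) n j).symm
  let w : Sobolev d s := ⟨v, g, hvg⟩
  have hw : stokesPow d s w = g := (isStokesPow_stokesPow w).unique hvg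
  refine ⟨w, ?_⟩
  rw [tendsto_iff_norm_sub_tendsto_zero] at hg ⊢
  refine hg.congr fun k => ?_
  rw [Sobolev.norm_def, map_sub, hw]
  rfl

/-! ### Paths of finite `p`-variation -/

section PVar

variable {V : Type*} [NormedAddCommGroup V] [NormedSpace ℝ V]

/-- The `p`-variation seminorm on `[0, T]`: the supremum runs over all partitions
`0 = u 0 ≤ u 1 ≤ ⋯ ≤ u n = T`. -/
def pVar (p T : ℝ) (f : ℝ → V) : ℝ≥0∞ :=
  (⨆ (n : ℕ) (u : ℕ → ℝ) (_ : Monotone u ∧ u 0 = 0 ∧ u n = T),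
    ∑ i ∈ Finset.range n, ‖f (u (i + 1)) - f (u i)‖ₑ ^ p) ^ (1 / p)

/-- The space `C^{p-var}(V)` on `[0, T]`: the closure of the smooth paths with respect to the
`p`-variation seminorm. -/
def PVarSpace (V : Type*) [NormedAddCommGroup V] [NormedSpace ℝ V] (p T : ℝ) : Set (ℝ → V) :=
  {f | ∀ η : ℝ≥0∞, 0 < η → ∃ g : ℝ → V, ContDiff ℝ ((⊤ : ℕ∞) : WithTop ℕ∞) g ∧ pVar p T (f - g) < η}

variable {Ω : Type*} [MeasurableSpace Ω]

/-- `‖X‖_{L^q(Ω; C^{p-var}(V))}` for a process `X`. -/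
def lqPVar (q p T : ℝ) (X : ℝ → Ω → V) (P : Measure Ω) : ℝ≥0∞ :=
  (∫⁻ ω, pVar p T (fun t => X t ω) ^ q ∂P) ^ (1 / q)

/-- The process `X` is an element of the Bochner space `L^q(Ω; C^{p-var}(V))`: its paths belong to
`C^{p-var}(V)`, it is an almost sure limit of simple `C^{p-var}(V)`-valued functions, and its
`L^q` norm is finite. -/
structure MemLqPVar (q p T : ℝ) (X : ℝ → Ω → V) (P : Measure Ω) : Prop where
  mem : ∀ᵐ ω ∂P, (fun t => X t ω) ∈ PVarSpace V p T
  stronglyMeasurable : ∃ S : ℕ → SimpleFunc Ω (ℝ → V),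
    (∀ n ω, S n ω ∈ PVarSpace V p T) ∧
    ∀ᵐ ω ∂P, Tendsto (fun n => pVar p T ((fun t => X t ω) - S n ω)) atTop (𝓝 0)
  norm_lt_top : lqPVar q p T X P < ⊤

/-! ### Fractional Brownian motion -/

/-- `X` is a real fractional Brownian motion on `[0, ∞)` with Hurst parameter `h`: a centred
Gaussian process with the fractional covariance and almost surely continuous paths. -/
structure IsFBM (h : ℝ) (X : ℝ≥0 → Ω → ℝ) (P : Measure Ω) : Prop where
  gaussian : IsGaussianProcess X P
  mean : ∀ t, ∫ ω, X t ω ∂P = 0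
  cov : ∀ s t : ℝ≥0, ∫ ω, X s ω * X t ω ∂P
    = ((s : ℝ) ^ (2 * h) + (t : ℝ) ^ (2 * h) - |(t : ℝ) - s| ^ (2 * h)) / 2
  continuous : ∀ᵐ ω ∂P, Continuous fun t => X t ω

end PVar

/-! ### The small scales -/

/-- The assumptions on the spatial structure of the noise. -/
structure IsNoiseBasis {d : ℕ} {ξ : ℝ} (σ : ℕ → ℝ) (e : ℕ → Sobolev d ξ) : Prop where
  orthonormal : Orthonormal ℝ fun k => Sobolev.incl (e k)
  orthogonal : Pairwise fun i j => inner ℝ (e i) (e j) = 0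
  nonneg : ∀ k, 0 ≤ σ k
  summable : Summable fun k => σ k ^ 2 * ‖e k‖ ^ 2

/-- The assumptions on the friction operator `C`, a densely defined closed operator on `H` with
`0` in its resolvent set and with `C e_k = λ_k e_k`. -/
structure IsFriction {d : ℕ} {ξ : ℝ} (C : HSpace d →ₗ.[ℝ] HSpace d) (e : ℕ → Sobolev d ξ)
    (lam : ℕ → ℝ) (γ : ℝ) : Prop where
  dense : Dense (C.domain : Set (HSpace d))
  closed : C.IsClosed
  resolvent : ∃ R : HSpace d →L[ℝ] HSpace d,
    (∀ x, (R x, x) ∈ C.graph) ∧ ∀ x : C.domain, R (C x) = x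
  eigen : ∀ k, (Sobolev.incl (e k), lam k • Sobolev.incl (e k)) ∈ C.graph
  lam_le : ∀ k, lam k ≤ lam 0
  lam_neg : lam 0 < 0
  nonneg : 0 ≤ γ
  coercive : ∃ c : ℝ, 0 < c ∧ ∀ x : C.domain, ∃ v : Sobolev d γ,
    Sobolev.incl v = (x : HSpace d) ∧ c * ‖v‖ ^ 2 ≤ -inner ℝ (x : HSpace d) (C x)

/-- The noise `W_t = ∑ₖ σ_k e_k W^k_t`, as a series in `H^ξ`. -/
def noise {Ω : Type*} {d : ℕ} {ξ : ℝ} (σ : ℕ → ℝ) (e : ℕ → Sobolev d ξ)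
    (B : ℕ → ℝ≥0 → Ω → ℝ) (t : ℝ) (ω : Ω) : Sobolev d ξ :=
  ∑' k, (σ k * B k t.toNNReal ω) • e k

/-- The path `w` solves `dw = ε⁻¹ C w dt + ε^{-h} dW`, `w_0 = 0`, on `[0, T]`. In integrated form:
for all `t`, the integral `∫₀ᵗ w_r dr` lies in the domain of `C`, and
`w_t = ε⁻¹ C ∫₀ᵗ w_r dr + ε^{-h} W_t`. For a closed densely defined operator `C` this is
equivalent to the weak formulation with test functions in the domain of the adjoint. -/
structure IsOUPath {d : ℕ} {ξ : ℝ} (C : HSpace d →ₗ.[ℝ] HSpace d) (h ε T : ℝ)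
    (W w : ℝ → Sobolev d ξ) : Prop where
  continuousOn : ContinuousOn w (Icc 0 T)
  initial : w 0 = 0
  equation : ∀ t ∈ Icc 0 T, ∃ x : C.domain,
    (x : HSpace d) = ∫ r in (0 : ℝ)..t, Sobolev.incl (w r) ∧
    Sobolev.incl (w t) = ε⁻¹ • C x + ε ^ (-h) • Sobolev.incl (W t)

/-- The integrated small scales `y_t = ∫₀ᵗ ε^{-α+h} w_r dr`. -/
def integratedOU {Ω : Type*} {d : ℕ} {ξ : ℝ} (α h ε : ℝ) (w : ℝ → Ω → Sobolev d ξ)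
    (t : ℝ) (ω : Ω) : Sobolev d ξ :=
  ∫ r in (0 : ℝ)..t, ε ^ (-α + h) • w r ω

end FastSlow

end

noncomputable section

namespace FastSlow

/-! ### Estimates for the `p`-variation -/

section PVarEstimates

variable {V : Type*} [NormedAddCommGroup V]

/-! The argument is pathwise; probability enters only through moments of one random constant. Put `μ
k = -lam k` and let `K_τ f(t) = ∫₀^∞ e^{-r} f(t - τ r) dr` (`expMean`) act on paths that vanish
before time `0`. Then `g = K_τ f` solves `τ g' = f - g`. Since each `e k` is an eigenvector of `C`,
the equation decouples, and with `τ = ε / μ k` variation of constants and an integration by parts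
give `w^ε = ε^{-h} ∑ σ_k (b_k - K_τ b_k) e_k`. Integrating this (`integral_fluctuation`) and
multiplying by `ε^{-1+h}` cancels all powers of `ε` and leaves `y^ε = ∑ (σ_k / μ_k) K_{ε/μ_k} b_k
e_k` (`smallScale`). This formula still makes sense at `ε = 0`, where `K_0` is the identity, and its
value there is `(-C)⁻¹ W` (`smallScale_mem_graph`). Closedness of `C` justifies applying it to the
series, and coercivity gives uniqueness, so the formula holds for every choice of solutions
(`integratedOU_eq`).

It remains to study `K_τ`. It averages translates, so it preserves Hölder constants for every `τ`,
and it changes by at most `M Γ(β+1) |τ - τ'|^β` in the supremum norm when `τ` changes. Interpolating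
between the two bounds, for `1/p < β < h`, makes the difference `1/p`-Hölder with constant of order
`|τ - τ'|^(β - 1/p)` (`IsHolder.expMean_sub_expMean`). As `μ k ≥ -lam 0 > 0`, these bounds are
uniform in `k`, and orthogonality in `H^ξ` sums them to a multiple of `R = √(seriesSize σ e M)`. A
`1/p`-Hölder bound controls the `p`-variation. Convergence, Hölder dependence on `ε` and the uniform
bound therefore all follow from `E[R^q] < ∞`, which `exists_driver` obtains from dyadic increments
and Gaussian moments.

Membership in the Bochner space uses the margin `β > 1/p`: smooth interpolation on a grid then
converges in `p`-variation, even if the node values carry an error as small as the mesh. -/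

theorem mem_Icc_of_partition {u : ℕ → ℝ} {n : ℕ} {T : ℝ}
    (hu : Monotone u ∧ u 0 = 0 ∧ u n = T) {i : ℕ} (hi : i ≤ n) : u i ∈ Icc 0 T :=
  ⟨hu.2.1 ▸ hu.1 (Nat.zero_le i), hu.2.2 ▸ hu.1 hi⟩

theorem pVar_congr {p T : ℝ} {f g : ℝ → V} (h : EqOn f g (Icc 0 T)) :
    pVar p T f = pVar p T g := by
  unfold pVar
  congr 1
  refine iSup_congr fun n => iSup_congr fun u => iSup_congr fun hu => ?_
  refine Finset.sum_congr rfl fun i hi => ?_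
  have hi' := Finset.mem_range.1 hi
  rw [h (mem_Icc_of_partition hu hi'), h (mem_Icc_of_partition hu hi'.le)]

/-- With exponent `1/p`, the `p`-th power of an increment is at most `M ^ p` times the length of its
interval, and the lengths of a partition add up to `T`. -/
theorem pVar_le_of_holder {p T M : ℝ} (hp : 0 < p) (hT : 0 ≤ T) (hM : 0 ≤ M) {f : ℝ → V}
    (hf : ∀ s ∈ Icc 0 T, ∀ t ∈ Icc 0 T, ‖f t - f s‖ ≤ M * |t - s| ^ (1 / p)) :
    pVar p T f ≤ ENNReal.ofReal (M * T ^ (1 / p)) := by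
  have key : (⨆ (n : ℕ) (u : ℕ → ℝ) (_ : Monotone u ∧ u 0 = 0 ∧ u n = T),
      ∑ i ∈ Finset.range n, ‖f (u (i + 1)) - f (u i)‖ₑ ^ p) ≤ ENNReal.ofReal (M ^ p * T) := by
    refine iSup_le fun n => iSup_le fun u => iSup_le fun hu => ?_
    calc ∑ i ∈ Finset.range n, ‖f (u (i + 1)) - f (u i)‖ₑ ^ p
        ≤ ∑ i ∈ Finset.range n, ENNReal.ofReal (M ^ p * (u (i + 1) - u i)) := by
          refine Finset.sum_le_sum fun i hi => ?_
          have hi' := Finset.mem_range.1 hi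
          have hle : 0 ≤ u (i + 1) - u i := sub_nonneg.2 (hu.1 (Nat.le_succ i))
          have h1 := hf _ (mem_Icc_of_partition hu hi'.le) _ (mem_Icc_of_partition hu hi')
          rw [← ofReal_norm, ENNReal.ofReal_rpow_of_nonneg (norm_nonneg _) hp.le]
          refine ENNReal.ofReal_le_ofReal ?_
          refine (Real.rpow_le_rpow (norm_nonneg _) h1 hp.le).trans_eq ?_
          rw [abs_of_nonneg hle, Real.mul_rpow hM (Real.rpow_nonneg hle _),
            ← Real.rpow_mul hle, one_div_mul_cancel hp.ne', Real.rpow_one]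
      _ = ENNReal.ofReal (M ^ p * T) := by
          rw [← ENNReal.ofReal_sum_of_nonneg, ← Finset.mul_sum, Finset.sum_range_sub, hu.2.1,
            hu.2.2, sub_zero]
          intro i _
          exact mul_nonneg (Real.rpow_nonneg hM _) (sub_nonneg.2 (hu.1 (Nat.le_succ i)))
  unfold pVar
  refine (ENNReal.rpow_le_rpow key (by positivity)).trans_eq ?_
  rw [ENNReal.ofReal_rpow_of_nonneg (by positivity) (by positivity),
    Real.mul_rpow (by positivity) hT, ← Real.rpow_mul hM, mul_one_div_cancel hp.ne', Real.rpow_one]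

theorem pVar_zero {p T : ℝ} (hp : 0 < p) : pVar p T (0 : ℝ → V) = 0 := by
  simp [pVar, hp]

/-! ### Smooth interpolation on a grid -/

variable [NormedSpace ℝ V]

/-- The `i`-th summand is the length of the part of `[i, i+1]` to the left of `x`. -/
theorem sum_range_clamp (n : ℕ) (x : ℝ) :
    ∑ i ∈ Finset.range n, max 0 (min 1 (x - i)) = max 0 (min (n : ℝ) x) := by
  induction n with
  | zero => simp
  | succ n ih =>
    rw [Finset.sum_range_succ, ih]
    push_cast
    have hn : (0 : ℝ) ≤ n := n.cast_nonneg
    rcases le_total x n with h1 | h1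
    · rw [min_eq_right h1, min_eq_right (by linarith : x ≤ n + 1),
        min_eq_right (by linarith : x - n ≤ 1), max_eq_left (by linarith : x - n ≤ 0), add_zero]
    · rw [min_eq_left h1, max_eq_right hn]
      rcases le_total x (n + 1) with h2 | h2
      · rw [min_eq_right h2, min_eq_right (by linarith : x - n ≤ 1),
          max_eq_right (by linarith : 0 ≤ x - n), max_eq_right (by linarith : 0 ≤ x)]
        ring
      · rw [min_eq_left h2, min_eq_left (by linarith : 1 ≤ x - n), max_eq_right zero_le_one,
          max_eq_right (by linarith)]

/-- The transition function is constant outside `[0, 1]`, so its Lipschitz bound can be measured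
between clamped arguments. In this form the bounds for all integer shifts add up without a factor
counting the shifts. -/
theorem exists_smoothTransition_sub_le : ∃ c : ℝ, 0 ≤ c ∧ ∀ x y : ℝ,
    |Real.smoothTransition x - Real.smoothTransition y|
      ≤ c * |max 0 (min 1 x) - max 0 (min 1 y)| := by
  obtain ⟨K, hK⟩ := ContDiffOn.exists_lipschitzOnWith (s := Icc (0 : ℝ) 1)
    (Real.smoothTransition.contDiff (n := 1)).contDiffOn (by simp) (convex_Icc 0 1) isCompact_Icc
  refine ⟨K, K.2, fun x y => ?_⟩
  have hmem : ∀ z : ℝ, max 0 (min 1 z) ∈ Icc (0 : ℝ) 1 := fun z =>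
    ⟨le_max_left _ _, max_le zero_le_one (min_le_left _ _)⟩
  have h := hK.dist_le_mul _ (hmem x) _ (hmem y)
  have hp : ∀ z : ℝ, Real.smoothTransition (max 0 (min 1 z)) = Real.smoothTransition z :=
    fun z => Real.smoothTransition.projIcc
  rwa [hp, hp, Real.dist_eq, Real.dist_eq] at h

/-- A Lipschitz constant of the smooth transition function. -/
def transitionConst : ℝ := exists_smoothTransition_sub_le.choose

theorem transitionConst_nonneg : 0 ≤ transitionConst := exists_smoothTransition_sub_le.choose_spec.1

theorem sum_range_abs_smoothTransition_sub_le (n : ℕ) (x y : ℝ) :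
    ∑ i ∈ Finset.range n, |Real.smoothTransition (x - i) - Real.smoothTransition (y - i)|
      ≤ transitionConst * |x - y| := by
  wlog hxy : y ≤ x generalizing x y
  · have := this y x (le_of_not_ge hxy)
    rw [abs_sub_comm x y]
    refine le_trans (le_of_eq (Finset.sum_congr rfl fun i _ => abs_sub_comm _ _)) this
  calc ∑ i ∈ Finset.range n, |Real.smoothTransition (x - i) - Real.smoothTransition (y - i)|
      ≤ ∑ i ∈ Finset.range n,
        transitionConst * (max 0 (min 1 (x - i)) - max 0 (min 1 (y - i))) := by
        refine Finset.sum_le_sum fun i _ => ?_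
        refine (exists_smoothTransition_sub_le.choose_spec.2 _ _).trans_eq ?_
        rw [abs_of_nonneg]
        · rfl
        · refine sub_nonneg.2 (max_le_max le_rfl (min_le_min le_rfl (by linarith)))
    _ = transitionConst * (max 0 (min (n : ℝ) x) - max 0 (min (n : ℝ) y)) := by
        rw [← Finset.mul_sum, Finset.sum_sub_distrib, sum_range_clamp, sum_range_clamp]
    _ ≤ transitionConst * |x - y| := by
        refine mul_le_mul_of_nonneg_left ?_ transitionConst_nonneg
        rw [abs_of_nonneg (sub_nonneg.2 hxy), sub_le_iff_le_add]
        refine max_le (add_nonneg (sub_nonneg.2 hxy) (le_max_left _ _)) ?_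
        have h1 : min (n : ℝ) x ≤ x - y + min (n : ℝ) y := by
          rw [← min_add_add_left]
          exact min_le_min (by linarith) (by linarith)
        linarith [le_max_right 0 (min (n : ℝ) y)]

/-- The smooth path that takes the values `v 0, …, v n` at the nodes `0, T / n, …, T`. -/
def gridPath (T : ℝ) (n : ℕ) (v : ℕ → V) (t : ℝ) : V :=
  v 0 + ∑ i ∈ Finset.range n, Real.smoothTransition (t * n / T - i) • (v (i + 1) - v i)

theorem contDiff_gridPath (T : ℝ) (n : ℕ) (v : ℕ → V) :
    ContDiff ℝ ((⊤ : ℕ∞) : WithTop ℕ∞) (gridPath T n v) := by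
  unfold gridPath
  refine contDiff_const.add (ContDiff.sum fun i _ => ContDiff.smul ?_ contDiff_const)
  exact Real.smoothTransition.contDiff.comp (by fun_prop)

theorem gridPath_node {T : ℝ} (hT : 0 < T) {n : ℕ} (hn : 0 < n) (v : ℕ → V) {j : ℕ} (hj : j ≤ n) :
    gridPath T n v (T * j / n) = v j := by
  have hn' : (0 : ℝ) < n := by exact_mod_cast hn
  have hx : T * j / n * n / T = j := by field_simp
  have h2 : ∑ i ∈ Finset.range n, Real.smoothTransition ((j : ℝ) - i) • (v (i + 1) - v i)
      = ∑ i ∈ Finset.range j, (v (i + 1) - v i) := by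
    rw [← Finset.sum_subset (Finset.range_subset_range.2 hj)]
    · refine Finset.sum_congr rfl fun i hi => ?_
      have : (i : ℝ) + 1 ≤ j := by exact_mod_cast Finset.mem_range.1 hi
      rw [Real.smoothTransition.one_of_one_le (by linarith), one_smul]
    · intro i _ hi
      have : (j : ℝ) ≤ i := by exact_mod_cast not_lt.1 fun h => hi (Finset.mem_range.2 h)
      rw [Real.smoothTransition.zero_of_nonpos (by linarith), zero_smul]
  rw [gridPath, hx, h2, Finset.sum_range_sub]
  abel

/-- The slope is the largest jump divided by the mesh `T / n`, up to a constant independent of `n`.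
-/
theorem norm_gridPath_sub_le {T : ℝ} (hT : 0 < T) {n : ℕ} {v : ℕ → V} {a : ℝ}
    (ha : 0 ≤ a) (hv : ∀ i < n, ‖v (i + 1) - v i‖ ≤ a) (s t : ℝ) :
    ‖gridPath T n v t - gridPath T n v s‖ ≤ transitionConst * a * (|t - s| / (T / n)) := by
  have h1 : gridPath T n v t - gridPath T n v s = ∑ i ∈ Finset.range n,
      (Real.smoothTransition (t * n / T - i) - Real.smoothTransition (s * n / T - i))
        • (v (i + 1) - v i) := by
    simp only [gridPath, sub_smul, Finset.sum_sub_distrib]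
    abel
  rw [h1]
  calc _ ≤ ∑ i ∈ Finset.range n,
        |Real.smoothTransition (t * n / T - i) - Real.smoothTransition (s * n / T - i)| * a := by
        refine (norm_sum_le _ _).trans (Finset.sum_le_sum fun i hi => ?_)
        rw [norm_smul, Real.norm_eq_abs]
        exact mul_le_mul_of_nonneg_left (hv i (Finset.mem_range.1 hi)) (abs_nonneg _)
    _ ≤ transitionConst * |t * n / T - s * n / T| * a := by
        rw [← Finset.sum_mul]
        exact mul_le_mul_of_nonneg_right (sum_range_abs_smoothTransition_sub_le _ _ _) ha
    _ = transitionConst * a * (|t - s| / (T / n)) := by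
        rw [← sub_div, ← sub_mul, abs_div, abs_mul, abs_of_pos hT,
          abs_of_nonneg (n.cast_nonneg : (0 : ℝ) ≤ n), div_div_eq_mul_div]
        ring

/-- Below the mesh size, both `f` and the interpolation have small increments; above it, the uniform
distance between them suffices. The tolerance `η` at the nodes allows random values there to be
replaced by simple functions. -/
theorem norm_sub_gridPath_sub_le {T M η β κ : ℝ} (hT : 0 < T) {n : ℕ} (hn : 0 < n) (hM : 0 ≤ M)
    (hκ : 0 < κ) (hκβ : κ ≤ β) (hκ1 : κ ≤ 1) {f : ℝ → V}
    (hf : ∀ s ∈ Icc 0 T, ∀ t ∈ Icc 0 T, ‖f t - f s‖ ≤ M * |t - s| ^ β)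
    {v : ℕ → V} (hv : ∀ i ≤ n, ‖v i - f (T * i / n)‖ ≤ η) {s t : ℝ}
    (hs : s ∈ Icc 0 T) (ht : t ∈ Icc 0 T) :
    ‖(f t - gridPath T n v t) - (f s - gridPath T n v s)‖
      ≤ (2 + 4 * transitionConst) * (M * (T / n) ^ β + η) * (|t - s| / (T / n)) ^ κ := by
  have hn' : (0 : ℝ) < n := by exact_mod_cast hn
  set δ := T / n with hδ
  have hδ0 : 0 < δ := div_pos hT hn'
  have hc := transitionConst_nonneg
  set c := transitionConst
  have hη : 0 ≤ η := (norm_nonneg _).trans (hv 0 (Nat.zero_le _))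
  set A := M * δ ^ β + η with hA
  have hδβ : 0 ≤ δ ^ β := Real.rpow_nonneg hδ0.le _
  have hA0 : 0 ≤ A := add_nonneg (mul_nonneg hM hδβ) hη
  have node : ∀ i ≤ n, T * i / n ∈ Icc 0 T := fun i hi => by
    have : (i : ℝ) ≤ n := by exact_mod_cast hi
    exact ⟨by positivity, by rw [div_le_iff₀ hn']; gcongr⟩
  have hinc : ∀ i < n, ‖v (i + 1) - v i‖ ≤ 2 * A := by
    intro i hi
    have h1 := hv (i + 1) hi
    have h2 := hv i hi.le
    have h3 := hf _ (node i hi.le) _ (node (i + 1) hi)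
    have h4 : |T * ((i + 1 : ℕ) : ℝ) / n - T * i / n| = δ := by
      rw [show T * ((i + 1 : ℕ) : ℝ) / n - T * i / n = δ by rw [hδ]; push_cast; ring]
      exact abs_of_pos hδ0
    rw [h4] at h3
    have h5 : v (i + 1) - v i = (v (i + 1) - f (T * ((i + 1 : ℕ) : ℝ) / n))
        + (f (T * ((i + 1 : ℕ) : ℝ) / n) - f (T * i / n)) - (v i - f (T * i / n)) := by abel
    rw [h5]
    refine (norm_sub_le _ _).trans ?_
    have := norm_add_le (v (i + 1) - f (T * ((i + 1 : ℕ) : ℝ) / n))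
      (f (T * ((i + 1 : ℕ) : ℝ) / n) - f (T * i / n))
    have h6 : 0 ≤ M * δ ^ β := mul_nonneg hM hδβ
    linarith
  have hlip := norm_gridPath_sub_le (V := V) hT (n := n) (v := v) (a := 2 * A) (by positivity) hinc
  rcases le_total (|t - s| / δ) 1 with hr | hr
  · set r := |t - s| / δ with hrdef
    have hr0 : 0 ≤ r := by positivity
    have hts : |t - s| = r * δ := by rw [hrdef]; field_simp
    have h1 : ‖f t - f s‖ ≤ A * r ^ κ := by
      refine (hf s hs t ht).trans ?_
      rw [hts, Real.mul_rpow hr0 hδ0.le]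
      have h2 : r ^ β ≤ r ^ κ := by
        rcases hr0.eq_or_lt with h | h
        · rw [← h, Real.zero_rpow hκ.ne', Real.zero_rpow (hκ.trans_le hκβ).ne']
        · exact Real.rpow_le_rpow_of_exponent_ge h hr hκβ
      have h3 : 0 ≤ r ^ κ := Real.rpow_nonneg hr0 _
      calc M * (r ^ β * δ ^ β) ≤ M * (r ^ κ * δ ^ β) := by gcongr
        _ = (M * δ ^ β) * r ^ κ := by ring
        _ ≤ A * r ^ κ := by gcongr; linarith
    have h2 : ‖gridPath T n v t - gridPath T n v s‖ ≤ c * (2 * A) * r ^ κ := by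
      refine (hlip s t).trans ?_
      refine mul_le_mul_of_nonneg_left ?_ (by positivity)
      rcases hr0.eq_or_lt with h | h
      · rw [← hδ, ← hrdef, ← h, Real.zero_rpow hκ.ne']
      · have := Real.rpow_le_rpow_of_exponent_ge h hr hκ1
        rwa [Real.rpow_one] at this
    have h3 : (f t - gridPath T n v t) - (f s - gridPath T n v s)
        = (f t - f s) - (gridPath T n v t - gridPath T n v s) := by abel
    rw [h3]
    refine (norm_sub_le _ _).trans ((add_le_add h1 h2).trans ?_)
    have h4 : 0 ≤ A * r ^ κ := by positivity
    have h5 : 0 ≤ c * A * r ^ κ := by positivity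
    nlinarith
  -- Beyond the mesh size, compare `x` with the last node before it; the factor `(|t - s| / δ) ^ κ ≥
  -- 1` is then free.
  · have hsup : ∀ x ∈ Icc 0 T, ‖f x - gridPath T n v x‖ ≤ (1 + 2 * c) * A := by
      intro x hx
      set j := ⌊x / δ⌋₊ with hj
      have hx0 : 0 ≤ x / δ := div_nonneg hx.1 hδ0.le
      have hj1 : (j : ℝ) ≤ x / δ := Nat.floor_le hx0
      have hj2 : x / δ < j + 1 := Nat.lt_floor_add_one _
      have hjn : j ≤ n := by
        have : x / δ ≤ n := by rw [div_le_iff₀ hδ0, hδ]; field_simp; exact hx.2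
        exact_mod_cast hj1.trans this
      have hnode : T * j / n = j * δ := by rw [hδ]; ring
      have hd : |x - T * j / n| ≤ δ := by
        rw [hnode, abs_of_nonneg (by rw [sub_nonneg]; rwa [le_div_iff₀ hδ0] at hj1)]
        rw [div_lt_iff₀ hδ0] at hj2
        linarith
      have h1 : ‖f x - f (T * j / n)‖ ≤ M * δ ^ β := by
        refine (hf _ (node j hjn) _ hx).trans (mul_le_mul_of_nonneg_left ?_ hM)
        exact Real.rpow_le_rpow (abs_nonneg _) hd (hκ.le.trans hκβ)
      have h2 : ‖gridPath T n v x - gridPath T n v (T * j / n)‖ ≤ c * (2 * A) := by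
        refine (hlip _ x).trans ?_
        refine mul_le_of_le_one_right (by positivity) ?_
        rw [← hδ]
        exact (div_le_one hδ0).2 hd
      have h3 := hv j hjn
      rw [gridPath_node hT hn v hjn] at h2
      have h4 : f x - gridPath T n v x = (f x - f (T * j / n)) - (v j - f (T * j / n))
        - (gridPath T n v x - v j) := by abel
      rw [h4]
      refine (norm_sub_le _ _).trans ?_
      have := norm_sub_le (f x - f (T * j / n)) (v j - f (T * j / n))
      linarith
    refine (norm_sub_le _ _).trans ((add_le_add (hsup t ht) (hsup s hs)).trans ?_)
    have h1 : 1 ≤ (|t - s| / δ) ^ κ := Real.one_le_rpow hr hκ.le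
    calc (1 + 2 * c) * A + (1 + 2 * c) * A = (2 + 4 * c) * A * 1 := by ring
      _ ≤ _ := by gcongr

theorem pVar_sub_gridPath_le {T M η β p : ℝ} (hT : 0 < T) {n : ℕ} (hn : 0 < n) (hM : 0 ≤ M)
    (hp : 1 ≤ p) (hβ : 1 / p ≤ β) {f : ℝ → V}
    (hf : ∀ s ∈ Icc 0 T, ∀ t ∈ Icc 0 T, ‖f t - f s‖ ≤ M * |t - s| ^ β)
    {v : ℕ → V} (hv : ∀ i ≤ n, ‖v i - f (T * i / n)‖ ≤ η) :
    pVar p T (f - gridPath T n v)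
      ≤ ENNReal.ofReal ((2 + 4 * transitionConst) * (M * (T / n) ^ β + η) * n ^ (1 / p)) := by
  have hp0 : 0 < p := zero_lt_one.trans_le hp
  have hn' : (0 : ℝ) < n := by exact_mod_cast hn
  have hη : 0 ≤ η := (norm_nonneg _).trans (hv 0 (Nat.zero_le _))
  have hc := transitionConst_nonneg
  have hδ0 : 0 < T / n := div_pos hT hn'
  have key := pVar_le_of_holder (p := p) (T := T) (f := f - gridPath T n v)
    (M := (2 + 4 * transitionConst) * (M * (T / n) ^ β + η) * ((T / n) ^ (1 / p))⁻¹) hp0 hT.le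
    (by positivity) ?_
  · refine key.trans_eq ?_
    congr 1
    rw [mul_assoc]
    congr 1
    rw [Real.div_rpow hT.le hn'.le]
    have : 0 < T ^ (1 / p) := Real.rpow_pos_of_pos hT _
    field_simp
  · intro s hs t ht
    refine (norm_sub_gridPath_sub_le hT hn hM (by positivity) hβ
      ((div_le_one hp0).2 hp) hf hv hs ht).trans_eq ?_
    rw [Real.div_rpow (abs_nonneg _) hδ0.le]
    ring

/-- The interpolation error decays like `n ^ (κ - β)` and the node error `1 / n` contributes `n ^ (κ
- 1)`. For `κ = 1 / p` these are the places where `β > 1 / p` and `p > 1` are needed. -/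
theorem tendsto_gridPath_bound {T β κ : ℝ} (hT : 0 < T) (hκβ : κ < β) (hκ1 : κ < 1) (c M : ℝ) :
    Tendsto (fun n : ℕ => ENNReal.ofReal (c * (M * (T / (n + 1 : ℕ)) ^ β + 1 / (n + 1 : ℕ))
      * ((n + 1 : ℕ) : ℝ) ^ κ)) atTop (𝓝 0) := by
  have h0 : ∀ a : ℝ, 0 < a → Tendsto (fun n : ℕ => ((n + 1 : ℕ) : ℝ) ^ (-a)) atTop (𝓝 0) :=
    fun a ha => (tendsto_rpow_neg_atTop ha).comp
      (tendsto_natCast_atTop_atTop.comp (tendsto_add_atTop_nat 1))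
  have h1 := ((h0 (β - κ) (by linarith)).const_mul (c * M * T ^ β)).add
    ((h0 (1 - κ) (by linarith)).const_mul c)
  simp only [mul_zero, add_zero] at h1
  rw [← ENNReal.ofReal_zero]
  refine ENNReal.tendsto_ofReal (h1.congr fun n => ?_)
  have hn : (0 : ℝ) < ((n + 1 : ℕ) : ℝ) := by positivity
  rw [Real.div_rpow hT.le hn.le, neg_sub, neg_sub, Real.rpow_sub hn, Real.rpow_sub hn,
    Real.rpow_one]
  ring

theorem mem_pVarSpace_of_holder {T M β p : ℝ} (hT : 0 < T) (hM : 0 ≤ M) (hp : 1 < p)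
    (hβ : 1 / p < β) {f : ℝ → V}
    (hf : ∀ s ∈ Icc 0 T, ∀ t ∈ Icc 0 T, ‖f t - f s‖ ≤ M * |t - s| ^ β) :
    f ∈ PVarSpace V p T := by
  intro η hη
  have hp0 : 0 < p := zero_lt_one.trans hp
  have h := tendsto_gridPath_bound hT hβ ((div_lt_one hp0).2 hp) (2 + 4 * transitionConst) M
  obtain ⟨n, hn⟩ := (h.eventually_lt_const hη).exists
  refine ⟨gridPath T (n + 1) fun i => f (T * i / (n + 1 : ℕ)), contDiff_gridPath _ _ _, ?_⟩
  refine lt_of_le_of_lt (pVar_sub_gridPath_le hT n.succ_pos hM hp.le hβ.le hf fun i _ => ?_) hn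
  rw [sub_self, norm_zero]
  positivity

theorem mem_pVarSpace_of_contDiff {p T : ℝ} (hp : 0 < p) {g : ℝ → V}
    (hg : ContDiff ℝ ((⊤ : ℕ∞) : WithTop ℕ∞) g) : g ∈ PVarSpace V p T :=
  fun η hη => ⟨g, hg, by rwa [sub_self, pVar_zero hp]⟩

end PVarEstimates

/-! ### Measurability in spaces of paths -/

section PVarMeasurability

variable {V : Type*} [NormedAddCommGroup V] {Ω : Type*} [MeasurableSpace Ω] {P : Measure Ω}

/-- Writing the tuple as a finite sum of coordinate embeddings avoids any separability assumption on
`V`. -/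
theorem aestronglyMeasurable_pi {ι : Type*} [Fintype ι] {X : ι → Ω → V}
    (hX : ∀ i, AEStronglyMeasurable (X i) P) :
    AEStronglyMeasurable (fun ω i => X i ω) P := by
  classical
  have h : (fun ω i => X i ω) = ∑ i, fun ω => (Pi.single i (X i ω) : ι → V) := by
    ext ω i
    simp [Finset.sum_apply, Pi.single_apply]
  rw [h]
  exact Finset.aestronglyMeasurable_sum _ fun i _ =>
    (continuous_single i).comp_aestronglyMeasurable (hX i)

/-- The extension of a finite sequence by zero. -/
def finExtend {n : ℕ} (v : Fin n → V) (i : ℕ) : V := if h : i < n then v ⟨i, h⟩ else 0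

theorem finExtend_of_lt {n : ℕ} (v : Fin n → V) {i : ℕ} (h : i < n) :
    finExtend v i = v ⟨i, h⟩ := dif_pos h

theorem exists_simpleFunc_measure_le [IsFiniteMeasure P] {X : Ω → V}
    (hX : AEStronglyMeasurable X P) {η r : ℝ≥0∞} (hη : 0 < η) (hr : 0 < r) :
    ∃ S : SimpleFunc Ω V, P {ω | η ≤ edist (S ω) (X ω)} ≤ r := by
  have h1 : ∀ᵐ ω ∂P, Tendsto (fun n => hX.stronglyMeasurable_mk.approx n ω) atTop (𝓝 (X ω)) := by
    filter_upwards [hX.ae_eq_mk] with ω hω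
    rw [hω]
    exact hX.stronglyMeasurable_mk.tendsto_approx ω
  have h2 := tendstoInMeasure_of_tendsto_ae
    (fun n => (hX.stronglyMeasurable_mk.approx n).stronglyMeasurable.aestronglyMeasurable) h1 η hη
  obtain ⟨n, hn⟩ := (h2.eventually_lt_const hr).exists
  exact ⟨_, hn.le⟩

/-- Approximate the values at the nodes by a simple function, up to `1 / (n + 1)` outside an event
of probability at most `2⁻ⁿ`, and interpolate smoothly. By Borel–Cantelli the approximation is
eventually good almost surely, and the grid bound tends to zero. -/
theorem exists_simpleFunc_tendsto_pVar [NormedSpace ℝ V] [IsFiniteMeasure P] {T β p : ℝ}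
    (hT : 0 < T) (hp : 1 < p) (hβ : 1 / p < β) {X : ℝ → Ω → V}
    (hX : ∀ t, AEStronglyMeasurable (X t) P) {M : Ω → ℝ} (hM : ∀ ω, 0 ≤ M ω)
    (hXM : ∀ᵐ ω ∂P, ∀ s ∈ Icc 0 T, ∀ t ∈ Icc 0 T, ‖X t ω - X s ω‖ ≤ M ω * |t - s| ^ β) :
    ∃ S : ℕ → SimpleFunc Ω (ℝ → V), (∀ n ω, S n ω ∈ PVarSpace V p T) ∧
      ∀ᵐ ω ∂P, Tendsto (fun n => pVar p T ((fun t => X t ω) - S n ω)) atTop (𝓝 0) := by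
  have hp0 : 0 < p := zero_lt_one.trans hp
  -- A grid with `n + 1` intervals has `n + 2` nodes.
  have hs : ∀ n : ℕ, ∃ S : SimpleFunc Ω (Fin (n + 2) → V),
      P {ω | ENNReal.ofReal (1 / (n + 1 : ℕ)) ≤
        edist (S ω) fun i => X (T * (i : ℕ) / (n + 1 : ℕ)) ω} ≤ (2⁻¹ : ℝ≥0∞) ^ n := fun n =>
    exists_simpleFunc_measure_le (aestronglyMeasurable_pi fun i => hX _)
      (ENNReal.ofReal_pos.2 (by positivity)) (ENNReal.pow_pos (by simp) n)
  choose S hS using hs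
  have hev := ae_eventually_notMem (μ := P) (ne_top_of_le_ne_top (b := ∑' n : ℕ, (2⁻¹ : ℝ≥0∞) ^ n)
    (by rw [ENNReal.tsum_geometric]; simp) (ENNReal.tsum_le_tsum hS))
  refine ⟨fun n => (S n).map fun v => gridPath T (n + 1) (finExtend v),
    fun n ω => mem_pVarSpace_of_contDiff hp0 (contDiff_gridPath T (n + 1) (finExtend (S n ω))), ?_⟩
  filter_upwards [hXM, hev] with ω hω hω'
  refine tendsto_of_tendsto_of_tendsto_of_le_of_le' tendsto_const_nhds
    (tendsto_gridPath_bound hT hβ ((div_lt_one hp0).2 hp) (2 + 4 * transitionConst) (M ω))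
    (Eventually.of_forall fun _ => zero_le) ?_
  filter_upwards [hω'] with n hn
  have hv : ∀ i ≤ n + 1, ‖finExtend (S n ω) i - X (T * i / (n + 1 : ℕ)) ω‖ ≤ 1 / (n + 1 : ℕ) := by
    intro i hi
    simp only [not_le] at hn
    have h1 := (edist_le_pi_edist (S n ω) (fun i => X (T * (i : ℕ) / (n + 1 : ℕ)) ω)
      ⟨i, by omega⟩).trans hn.le
    rw [edist_dist, dist_eq_norm] at h1
    rw [finExtend_of_lt _ (by omega)]
    exact (ENNReal.ofReal_le_ofReal_iff (by positivity)).1 h1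
  exact pVar_sub_gridPath_le hT n.succ_pos (hM ω) hp.le hβ.le hω hv

/-! ### Measurability of uncountable suprema. -/

theorem aemeasurable_iSup_of_continuous {ι : Type*} [TopologicalSpace ι]
    [SecondCountableTopology ι] {f : ι → Ω → ℝ≥0∞} (hf : ∀ i, AEMeasurable (f i) P)
    (hc : ∀ᵐ ω ∂P, Continuous fun i => f i ω) : AEMeasurable (fun ω => ⨆ i, f i ω) P := by
  obtain ⟨D, hD, hd⟩ := TopologicalSpace.exists_countable_dense ι
  refine (AEMeasurable.biSup D hD fun i _ => hf i).congr ?_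
  filter_upwards [hc] with ω hω
  refine le_antisymm (iSup₂_le fun i _ => le_iSup (fun i => f i ω) i) (iSup_le fun i => ?_)
  have hcl : IsClosed {i | f i ω ≤ ⨆ j ∈ D, f j ω} := isClosed_le hω continuous_const
  exact hcl.closure_subset_iff.2 (fun j hj => le_iSup₂ (f := fun j _ => f j ω) j hj) (hd i)

/-- The `p`-variation in terms of a supremum over the type of partitions. -/
theorem pVar_eq_iSup_subtype (p T : ℝ) (f : ℝ → V) :
    pVar p T f = (⨆ (n : ℕ) (u : {u : ℕ → ℝ // Monotone u ∧ u 0 = 0 ∧ u n = T}),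
      ∑ i ∈ Finset.range n, ‖f (u.1 (i + 1)) - f (u.1 i)‖ₑ ^ p) ^ (1 / p) := by
  unfold pVar
  simp only [iSup_subtype]

/-- For a fixed number of intervals the variation sum is continuous in the parameter and the
partition jointly, so a countable dense set of pairs suffices for that supremum; the remaining one,
over `n`, is countable. -/
theorem aemeasurable_iSup_pVar_rpow {ι : Type*} [TopologicalSpace ι] [SecondCountableTopology ι]
    {p q T : ℝ} (hp : 0 < p) (hq : 0 < q) {Y : ι → ℝ → Ω → V}
    (hY : ∀ ε t, AEStronglyMeasurable (Y ε t) P)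
    (hc : ∀ᵐ ω ∂P, Continuous fun x : ι × ℝ => Y x.1 x.2 ω) :
    AEMeasurable (fun ω => ⨆ ε, pVar p T (fun t => Y ε t ω) ^ q) P := by
  have hr : 0 < 1 / p * q := by positivity
  have h1 : ∀ ω, (⨆ ε, pVar p T (fun t => Y ε t ω) ^ q)
      = (⨆ (n : ℕ) (x : ι × {u : ℕ → ℝ // Monotone u ∧ u 0 = 0 ∧ u n = T}),
        ∑ i ∈ Finset.range n, ‖Y x.1 (x.2.1 (i + 1)) ω - Y x.1 (x.2.1 i) ω‖ₑ ^ p)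
          ^ (1 / p * q) := by
    intro ω
    simp only [iSup_prod, pVar_eq_iSup_subtype, ← ENNReal.rpow_mul]
    -- A positive power is an order isomorphism of `ℝ≥0∞`, hence commutes with the supremum over the
    -- parameter.
    rw [iSup_comm, ← ENNReal.orderIsoRpow_apply (1 / p * q) hr, OrderIso.map_iSup]
    rfl
  simp only [h1]
  refine AEMeasurable.pow_const (AEMeasurable.iSup fun n => ?_) _
  have : SecondCountableTopology {u : ℕ → ℝ // Monotone u ∧ u 0 = 0 ∧ u n = T} :=
    TopologicalSpace.Subtype.secondCountableTopology {u | Monotone u ∧ u 0 = 0 ∧ u n = T}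
  refine aemeasurable_iSup_of_continuous (fun x => ?_) ?_
  · exact Finset.aemeasurable_fun_sum _ fun i _ => ((hY _ _).sub (hY _ _)).enorm.pow_const _
  · filter_upwards [hc] with ω hω
    refine continuous_finsetSum _ fun i _ => ?_
    refine ENNReal.continuous_rpow_const.comp (continuous_enorm.comp ?_)
    have hproj : ∀ j : ℕ, Continuous fun x : ι × {u : ℕ → ℝ // Monotone u ∧ u 0 = 0 ∧ u n = T} =>
        (x.1, x.2.1 j) := fun j =>
      continuous_fst.prodMk ((continuous_apply j).comp (continuous_subtype_val.comp continuous_snd))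
    exact (hω.comp (hproj (i + 1))).sub (hω.comp (hproj i))

end PVarMeasurability

/-! ### Exponential averages of Hölder continuous functions -/

section ExpMean

/-- The average `∫₀^∞ e^{-r} f(t - τ r) dr` of `f` over the past of `t`. -/
def expMean (τ : ℝ) (f : ℝ → ℝ) (t : ℝ) : ℝ := ∫ r in Ioi (0 : ℝ), Real.exp (-r) * f (t - τ * r)

/-- `f` is Hölder continuous on `ℝ` with exponent `β` and constant `M`. -/
def IsHolder (M β : ℝ) (f : ℝ → ℝ) : Prop := ∀ s t, |f t - f s| ≤ M * |t - s| ^ β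

variable {M β : ℝ} {f : ℝ → ℝ}

theorem IsHolder.nonneg (hf : IsHolder M β f) : 0 ≤ M := by
  simpa using (abs_nonneg _).trans (hf 0 1)

theorem IsHolder.continuous (hf : IsHolder M β f) (hβ : 0 < β) : Continuous f := by
  refine continuous_iff_continuousAt.2 fun s => ?_
  rw [ContinuousAt, tendsto_iff_norm_sub_tendsto_zero]
  have h : Tendsto (fun t : ℝ => M * |t - s| ^ β) (𝓝 s) (𝓝 0) := by
    have hc : Continuous fun t : ℝ => M * |t - s| ^ β :=
      continuous_const.mul ((by fun_prop : Continuous fun t : ℝ => |t - s|).rpow_const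
        fun _ => Or.inr hβ.le)
    simpa [Real.zero_rpow hβ.ne'] using hc.tendsto s
  exact squeeze_zero (fun _ => norm_nonneg _) (fun t => hf s t) h

theorem integrableOn_exp_neg : IntegrableOn (fun r : ℝ => Real.exp (-r)) (Ioi 0) := by
  simpa using Real.GammaIntegral_convergent one_pos

theorem integrableOn_exp_neg_mul_rpow (hβ : 0 < β) :
    IntegrableOn (fun r : ℝ => Real.exp (-r) * r ^ β) (Ioi 0) := by
  simpa using Real.GammaIntegral_convergent (add_pos hβ one_pos)

theorem IsHolder.integrableOn_expMean (hf : IsHolder M β f) (hβ : 0 < β) (τ t : ℝ) :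
    IntegrableOn (fun r => Real.exp (-r) * f (t - τ * r)) (Ioi 0) := by
  have hc := hf.continuous hβ
  have hg : IntegrableOn (fun r : ℝ => |f t| * Real.exp (-r)
      + M * |τ| ^ β * (Real.exp (-r) * r ^ β)) (Ioi 0) :=
    (integrableOn_exp_neg.const_mul _).add ((integrableOn_exp_neg_mul_rpow hβ).const_mul _)
  refine Integrable.mono' hg (by fun_prop) ?_
  refine (ae_restrict_iff' measurableSet_Ioi).2 (Eventually.of_forall fun r hr => ?_)
  have hr' : 0 < r := hr
  have h1 : |f (t - τ * r)| ≤ |f t| + M * (|τ| ^ β * r ^ β) := by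
    have h2 := hf t (t - τ * r)
    rw [sub_sub_cancel_left, abs_neg, abs_mul, abs_of_pos hr',
      Real.mul_rpow (abs_nonneg _) hr'.le] at h2
    have h3 := abs_add_le (f (t - τ * r) - f t) (f t)
    rw [sub_add_cancel] at h3
    linarith
  rw [norm_mul, Real.norm_eq_abs, Real.norm_eq_abs, Real.abs_exp]
  calc Real.exp (-r) * |f (t - τ * r)|
      ≤ Real.exp (-r) * (|f t| + M * (|τ| ^ β * r ^ β)) := by gcongr
    _ = _ := by ring

theorem expMean_zero (f : ℝ → ℝ) : expMean 0 f = f := by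
  ext t
  simp only [expMean, zero_mul, sub_zero, integral_mul_const, integral_exp_neg_Ioi_zero, one_mul]

/-- The weight `e^{-r}` has mass one, and all translates of `f` share its Hölder constant. -/
theorem IsHolder.expMean (hf : IsHolder M β f) (hβ : 0 < β) (τ : ℝ) :
    IsHolder M β (expMean τ f) := by
  intro s t
  have h1 := hf.integrableOn_expMean hβ τ
  unfold FastSlow.expMean
  rw [← integral_sub (h1 t) (h1 s), ← Real.norm_eq_abs]
  refine (norm_integral_le_of_norm_le (integrableOn_exp_neg.mul_const (M * |t - s| ^ β))
    (Eventually.of_forall fun r => ?_)).trans_eq ?_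
  · rw [← mul_sub, norm_mul, Real.norm_eq_abs, Real.abs_exp, Real.norm_eq_abs]
    refine mul_le_mul_of_nonneg_left ?_ (Real.exp_pos _).le
    refine (hf _ _).trans_eq ?_
    congr 3
    ring
  · rw [integral_mul_const, integral_exp_neg_Ioi_zero, one_mul]

/-- The two arguments of `f` differ by `r |τ - τ'|`, and `∫₀^∞ e^{-r} r^β dr = Γ(β + 1)`. -/
theorem IsHolder.abs_expMean_sub_expMean_le (hf : IsHolder M β f) (hβ : 0 < β) (τ τ' t : ℝ) :
    |FastSlow.expMean τ f t - FastSlow.expMean τ' f t| ≤ M * Real.Gamma (β + 1) * |τ - τ'| ^ β := by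
  have h1 := fun τ => hf.integrableOn_expMean hβ τ t
  unfold FastSlow.expMean
  rw [← integral_sub (h1 τ) (h1 τ'), ← Real.norm_eq_abs]
  refine (norm_integral_le_of_norm_le
    ((integrableOn_exp_neg_mul_rpow hβ).mul_const (M * |τ - τ'| ^ β)) ?_).trans_eq ?_
  · refine (ae_restrict_iff' measurableSet_Ioi).2 (Eventually.of_forall fun r hr => ?_)
    have hr' : 0 < r := hr
    rw [← mul_sub, norm_mul, Real.norm_eq_abs, Real.abs_exp, Real.norm_eq_abs, mul_assoc]
    refine mul_le_mul_of_nonneg_left ?_ (Real.exp_pos _).le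
    refine (hf _ _).trans_eq ?_
    rw [show t - τ * r - (t - τ' * r) = r * (τ' - τ) by ring, abs_mul, abs_of_pos hr',
      Real.mul_rpow hr'.le (abs_nonneg _), abs_sub_comm τ' τ]
    ring
  · rw [integral_mul_const, Real.Gamma_eq_integral (by linarith)]
    simp only [add_sub_cancel_right]
    ring

/-- The minimum of `a ^ β` and `b ^ β` is at most the weighted geometric mean `a ^ κ * b ^ (β - κ)`.
-/
theorem le_mul_rpow_mul_rpow {x A a b κ : ℝ} (hA : 0 ≤ A) (ha : 0 ≤ a) (hb : 0 ≤ b)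
    (hκ : 0 < κ) (hκβ : κ < β) (h1 : x ≤ A * a ^ β) (h2 : x ≤ A * b ^ β) :
    x ≤ A * a ^ κ * b ^ (β - κ) := by
  rcases le_total a b with hab | hab
  · refine h1.trans ?_
    rw [mul_assoc]
    refine mul_le_mul_of_nonneg_left ?_ hA
    rw [show a ^ β = a ^ κ * a ^ (β - κ) by
      rw [← Real.rpow_add_of_nonneg ha hκ.le (sub_pos.2 hκβ).le]; congr 1; ring]
    exact mul_le_mul_of_nonneg_left (Real.rpow_le_rpow ha hab (sub_pos.2 hκβ).le)
      (Real.rpow_nonneg ha _)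
  · refine h2.trans ?_
    rw [mul_assoc]
    refine mul_le_mul_of_nonneg_left ?_ hA
    rw [show b ^ β = b ^ κ * b ^ (β - κ) by
      rw [← Real.rpow_add_of_nonneg hb hκ.le (sub_pos.2 hκβ).le]; congr 1; ring]
    exact mul_le_mul_of_nonneg_right (Real.rpow_le_rpow hb hab hκ.le) (Real.rpow_nonneg hb _)

/-- The Hölder constant of a difference of exponential averages, by interpolation. -/
theorem IsHolder.expMean_sub_expMean (hf : IsHolder M β f) {κ : ℝ} (hκ : 0 < κ) (hκβ : κ < β)
    (τ τ' : ℝ) :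
    IsHolder (2 * (1 + Real.Gamma (β + 1)) * |τ - τ'| ^ (β - κ) * M) κ
      fun t => FastSlow.expMean τ f t - FastSlow.expMean τ' f t := by
  intro s t
  have hβ : 0 < β := hκ.trans hκβ
  have hM := hf.nonneg
  have hΓ : 0 < Real.Gamma (β + 1) := Real.Gamma_pos_of_pos (by linarith)
  have h1 := abs_sub (FastSlow.expMean τ f t - FastSlow.expMean τ f s)
    (FastSlow.expMean τ' f t - FastSlow.expMean τ' f s)
  have h2 := abs_sub (FastSlow.expMean τ f t - FastSlow.expMean τ' f t)
    (FastSlow.expMean τ f s - FastSlow.expMean τ' f s)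
  have h3 := hf.expMean hβ τ s t
  have h4 := hf.expMean hβ τ' s t
  have h5 := hf.abs_expMean_sub_expMean_le hβ τ τ' s
  have h6 := hf.abs_expMean_sub_expMean_le hβ τ τ' t
  have h7 : 0 ≤ M * Real.Gamma (β + 1) * |t - s| ^ β := by positivity
  have h8 : 0 ≤ M * |τ - τ'| ^ β := by positivity
  rw [show FastSlow.expMean τ f t - FastSlow.expMean τ f s
    - (FastSlow.expMean τ' f t - FastSlow.expMean τ' f s)
    = FastSlow.expMean τ f t - FastSlow.expMean τ' f t
      - (FastSlow.expMean τ f s - FastSlow.expMean τ' f s) by ring] at h1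
  -- The direct bounds have constants `2 M` in `|t - s| ^ β` and `2 M Γ(β + 1)` in `|τ - τ'| ^ β`;
  -- `A` dominates both.
  refine (le_mul_rpow_mul_rpow (A := 2 * (1 + Real.Gamma (β + 1)) * M) (by positivity)
    (abs_nonneg (t - s)) (abs_nonneg (τ - τ')) hκ hκβ ?_ ?_).trans_eq (by ring)
  · linarith
  · linarith

theorem expMean_of_nonpos (hf0 : ∀ t ≤ 0, f t = 0) {τ t : ℝ} (hτ : 0 ≤ τ) (ht : t ≤ 0) : expMean τ f t = 0 := by
  refine setIntegral_eq_zero_of_forall_eq_zero fun r hr => ?_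
  have : 0 ≤ τ * r := mul_nonneg hτ (le_of_lt hr)
  rw [hf0 _ (by linarith), mul_zero]

/-- Substitute `s = t - τ r`; the range `r > t / τ` contributes nothing because `f` vanishes before
time `0`. The result is the variation of constants formula. -/
theorem expMean_eq_integral (hf0 : ∀ t ≤ 0, f t = 0) {τ t : ℝ} (hτ : 0 < τ)
    (ht : 0 ≤ t) :
    expMean τ f t = τ⁻¹ * (Real.exp (-(t / τ)) * ∫ s in (0 : ℝ)..t, Real.exp (s / τ) * f s) := by
  have h1 : expMean τ f t = ∫ r in (0 : ℝ)..(t / τ), Real.exp (-r) * f (t - τ * r) := by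
    rw [intervalIntegral.integral_of_le (div_nonneg ht hτ.le), expMean]
    refine setIntegral_eq_of_subset_of_forall_sdiff_eq_zero measurableSet_Ioi
      Ioc_subset_Ioi_self fun r hr => ?_
    have hr1 : t / τ < r := not_le.1 fun h => hr.2 ⟨hr.1, h⟩
    rw [div_lt_iff₀ hτ] at hr1
    rw [hf0 _ (by linarith), mul_zero]
  have h2 := intervalIntegral.integral_comp_sub_mul (a := 0) (b := t / τ)
    (fun x => Real.exp ((x - t) / τ) * f x) hτ.ne' t
  have h3 : ∀ r, Real.exp ((t - τ * r - t) / τ) = Real.exp (-r) := fun r => by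
    congr 1
    field_simp
    ring
  simp only [h3, mul_zero, sub_zero, mul_div_cancel₀ t hτ.ne', sub_self] at h2
  rw [h1, h2, smul_eq_mul]
  have h4 : ∀ s, Real.exp ((s - t) / τ) * f s
      = Real.exp (-(t / τ)) * (Real.exp (s / τ) * f s) := fun s => by
    rw [← mul_assoc, ← Real.exp_add]
    congr 2
    ring
  simp only [h4, intervalIntegral.integral_const_mul]

/-- The exponential average solves `τ g' = f - g`, `g 0 = 0`. -/
theorem integral_sub_expMean (hf0 : ∀ t ≤ 0, f t = 0) (hc : Continuous f) {τ t : ℝ}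
    (hτ : 0 < τ) (ht : 0 ≤ t) :
    ∫ s in (0 : ℝ)..t, (f s - expMean τ f s) = τ * expMean τ f t := by
  -- `G` is the variation of constants formula taken on the whole line, so it is differentiable
  -- everywhere; it is identified with `expMean` only for times `≥ 0`.
  set G : ℝ → ℝ := fun t =>
    τ⁻¹ * (Real.exp (-(t / τ)) * ∫ s in (0 : ℝ)..t, Real.exp (s / τ) * f s) with hG
  have hd : ∀ x, HasDerivAt G (τ⁻¹ * (f x - G x)) x := by
    intro x
    have h1 : HasDerivAt (fun t : ℝ => Real.exp (-(t / τ))) (Real.exp (-(x / τ)) * -(1 / τ)) x :=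
      (((hasDerivAt_id x).div_const τ).neg).exp
    have h2 : HasDerivAt (fun t => ∫ s in (0 : ℝ)..t, Real.exp (s / τ) * f s)
        (Real.exp (x / τ) * f x) x :=
      (((by fun_prop : Continuous fun s => Real.exp (s / τ) * f s)).integral_hasStrictDerivAt
        0 x).hasDerivAt
    refine ((h1.mul h2).const_mul τ⁻¹).congr_deriv ?_
    have h3 : Real.exp (-(x / τ)) * (Real.exp (x / τ) * f x) = f x := by
      rw [← mul_assoc, ← Real.exp_add, neg_add_cancel, Real.exp_zero, one_mul]
    rw [h3, hG]
    ring
  have hGc : Continuous G := continuous_iff_continuousAt.2 fun x => (hd x).continuousAt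
  have h1 : ∫ s in (0 : ℝ)..t, (f s - expMean τ f s) = ∫ s in (0 : ℝ)..t, (f s - G s) := by
    refine intervalIntegral.integral_congr fun s hs => ?_
    rw [uIcc_of_le ht] at hs
    simp only [hG]
    rw [expMean_eq_integral hf0 hτ hs.1]
  have h2 := intervalIntegral.integral_eq_sub_of_hasDerivAt (a := 0) (b := t)
    (fun x _ => hd x) ((by fun_prop : Continuous fun x => τ⁻¹ * (f x - G x)).intervalIntegrable _ _)
  rw [intervalIntegral.integral_const_mul] at h2
  have h3 : G 0 = 0 := by simp [hG]
  rw [h1, expMean_eq_integral hf0 hτ ht]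
  change _ = τ * G t
  rw [h3, sub_zero] at h2
  rw [← h2, mul_inv_cancel_left₀ hτ.ne']

end ExpMean

/-- Continuity in time and measurability at each time give joint measurability, hence measurability
of the integral over the past. -/
theorem measurable_expMean {Ω : Type*} [MeasurableSpace Ω] {b : ℝ → Ω → ℝ}
    (hb : ∀ t, Measurable (b t)) (hc : ∀ ω, Continuous fun t => b t ω) (τ t : ℝ) :
    Measurable fun ω => expMean τ (fun s => b s ω) t := by
  have h1 : Measurable (Function.uncurry b) := measurable_uncurry_of_continuous_of_measurable hc hb
  have h2 : Measurable fun x : Ω × ℝ => Real.exp (-x.2) * b (t - τ * x.2) x.1 := by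
    refine Measurable.mul (by fun_prop) ?_
    exact h1.comp (Measurable.prodMk (by fun_prop) measurable_fst)
  exact (h2.stronglyMeasurable.integral_prod_right (ν := volume.restrict (Ioi 0))).measurable

/-! ### Orthogonal series of Hölder continuous functions -/

section OrthogonalSeries

variable {V : Type*} [NormedAddCommGroup V] {e : ℕ → V} {σ M c : ℕ → ℝ} {K : ℝ}

theorem sq_mul_norm_sq_le (hc : ∀ k, |c k| ≤ K * (|σ k| * M k)) (k : ℕ) :
    c k ^ 2 * ‖e k‖ ^ 2 ≤ K ^ 2 * (σ k ^ 2 * ‖e k‖ ^ 2 * M k ^ 2) := by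
  have h := pow_le_pow_left₀ (abs_nonneg _) (hc k) 2
  rw [sq_abs, mul_pow, mul_pow, sq_abs] at h
  calc c k ^ 2 * ‖e k‖ ^ 2 ≤ K ^ 2 * (σ k ^ 2 * M k ^ 2) * ‖e k‖ ^ 2 := by gcongr
    _ = _ := by ring

variable [InnerProductSpace ℝ V]

/-- The `e k` need be neither normalised nor nonzero in `V`, so Pythagoras is applied to the lines
they span. -/
theorem orthogonalFamily_span (he : Pairwise fun i j => inner ℝ (e i) (e j) = 0) :
    OrthogonalFamily ℝ (fun i => Submodule.span ℝ {e i})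
      (fun i => (Submodule.span ℝ {e i}).subtypeₗᵢ) := by
  intro i j hij x y
  obtain ⟨a, ha⟩ := Submodule.mem_span_singleton.1 x.2
  obtain ⟨b, hb⟩ := Submodule.mem_span_singleton.1 y.2
  simp only [Submodule.coe_subtypeₗᵢ, Submodule.subtype_apply, ← ha, ← hb, inner_smul_left,
    inner_smul_right, he hij, mul_zero]

theorem norm_sum_smul_sq (he : Pairwise fun i j => inner ℝ (e i) (e j) = 0) (a : ℕ → ℝ)
    (s : Finset ℕ) : ‖∑ k ∈ s, a k • e k‖ ^ 2 = ∑ k ∈ s, a k ^ 2 * ‖e k‖ ^ 2 := by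
  have h := (orthogonalFamily_span he).norm_sum
    (fun i => ⟨a i • e i, Submodule.smul_mem _ _ (Submodule.mem_span_singleton_self _)⟩) s
  simpa [norm_smul, mul_pow] using h

theorem summable_smul_of_orthogonal [CompleteSpace V]
    (he : Pairwise fun i j => inner ℝ (e i) (e j) = 0) {a : ℕ → ℝ}
    (ha : Summable fun k => a k ^ 2 * ‖e k‖ ^ 2) : Summable fun k => a k • e k := by
  have h := (orthogonalFamily_span he).summable_iff_norm_sq_summable
    (fun i => ⟨a i • e i, Submodule.smul_mem _ _ (Submodule.mem_span_singleton_self _)⟩)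
  simp only [Submodule.coe_subtypeₗᵢ, Submodule.subtype_apply, Submodule.coe_norm, norm_smul,
    mul_pow, Real.norm_eq_abs, sq_abs] at h
  exact h.2 ha

/-- The square of the size of a series with coefficients `σ k * b k`, where `b k` is of the order
of `M k`. -/
def seriesSize (σ : ℕ → ℝ) (e : ℕ → V) (M : ℕ → ℝ) : ℝ := ∑' k, σ k ^ 2 * ‖e k‖ ^ 2 * M k ^ 2

theorem norm_sum_smul_le (he : Pairwise fun i j => inner ℝ (e i) (e j) = 0)
    (hM : Summable fun k => σ k ^ 2 * ‖e k‖ ^ 2 * M k ^ 2) (hK : 0 ≤ K)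
    (hc : ∀ k, |c k| ≤ K * (|σ k| * M k)) (s : Finset ℕ) :
    ‖∑ k ∈ s, c k • e k‖ ≤ K * √(seriesSize σ e M) := by
  refine abs_le_of_sq_le_sq' ?_ (by positivity) |>.2
  have h0 : 0 ≤ seriesSize σ e M := tsum_nonneg fun k => by positivity
  rw [norm_sum_smul_sq he, mul_pow, Real.sq_sqrt h0, seriesSize]
  refine (Finset.sum_le_sum fun k _ => sq_mul_norm_sq_le hc k).trans ?_
  rw [← Finset.mul_sum]
  exact mul_le_mul_of_nonneg_left (hM.sum_le_tsum s fun k _ => by positivity) (sq_nonneg _)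

theorem summable_smul_of_abs_le [CompleteSpace V]
    (he : Pairwise fun i j => inner ℝ (e i) (e j) = 0)
    (hM : Summable fun k => σ k ^ 2 * ‖e k‖ ^ 2 * M k ^ 2)
    (hc : ∀ k, |c k| ≤ K * (|σ k| * M k)) : Summable fun k => c k • e k :=
  summable_smul_of_orthogonal he
    ((hM.mul_left (K ^ 2)).of_nonneg_of_le (fun k => by positivity) (sq_mul_norm_sq_le hc))

theorem norm_tsum_smul_le [CompleteSpace V]
    (he : Pairwise fun i j => inner ℝ (e i) (e j) = 0)
    (hM : Summable fun k => σ k ^ 2 * ‖e k‖ ^ 2 * M k ^ 2) (hK : 0 ≤ K)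
    (hc : ∀ k, |c k| ≤ K * (|σ k| * M k)) : ‖∑' k, c k • e k‖ ≤ K * √(seriesSize σ e M) :=
  le_of_tendsto (summable_smul_of_abs_le he hM hc).hasSum.norm
    (Eventually.of_forall fun s => norm_sum_smul_le he hM hK hc s)

/-- The paths `b k` are Hölder continuous and vanish before time `0`, and their Hölder constants
`M k` are such that the series `∑ₖ σ k * b k • e k` converges. -/
structure IsDriver (β : ℝ) (σ : ℕ → ℝ) (e : ℕ → V) (M : ℕ → ℝ) (b : ℕ → ℝ → ℝ) : Prop where
  holder : ∀ k, IsHolder (M k) β (b k)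
  zero : ∀ k, ∀ t ≤ 0, b k t = 0
  summable : Summable fun k => σ k ^ 2 * ‖e k‖ ^ 2 * M k ^ 2
  orthogonal : Pairwise fun i j => inner ℝ (e i) (e j) = 0

/-- The path `∑ₖ (σ k / μ k) (K_{ε/μ k} b k) • e k`, where `K` is the exponential average. -/
def smallScale (σ : ℕ → ℝ) (e : ℕ → V) (μ : ℕ → ℝ) (b : ℕ → ℝ → ℝ) (ε t : ℝ) : V :=
  ∑' k, (σ k / μ k * expMean (ε / μ k) (b k) t) • e k

/-- The difference between the driving path and its exponential averages. -/
def fluctuation (σ : ℕ → ℝ) (e : ℕ → V) (μ : ℕ → ℝ) (b : ℕ → ℝ → ℝ) (ε t : ℝ) : V :=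
  ∑' k, (σ k * (b k t - expMean (ε / μ k) (b k) t)) • e k

/-! ### Bounds for the driven series, uniform in the scale. -/

namespace IsDriver

variable {β m : ℝ} {μ : ℕ → ℝ} {b : ℕ → ℝ → ℝ}

theorem abs_expMean_le (hb : IsDriver β σ e M b) (hβ : 0 < β) {τ : ℝ} (hτ : 0 ≤ τ) (k : ℕ)
    (t : ℝ) : |expMean τ (b k) t| ≤ M k * |t| ^ β := by
  have h := (hb.holder k).expMean hβ τ 0 t
  rwa [expMean_of_nonpos (hb.zero k) hτ le_rfl, sub_zero, sub_zero] at h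

theorem abs_div_mul_le (hb : IsDriver β σ e M b) (hm : 0 < m) (hμ : ∀ k, m ≤ μ k) {x K : ℝ}
    (k : ℕ) (hx : |x| ≤ K * M k) : |σ k / μ k * x| ≤ K / m * (|σ k| * M k) := by
  have hM := (hb.holder k).nonneg
  have hμk : 0 < μ k := hm.trans_le (hμ k)
  rw [abs_mul, abs_div, abs_of_pos hμk]
  calc |σ k| / μ k * |x| ≤ |σ k| / m * (K * M k) := by
        gcongr
        exact hμ k
    _ = _ := by ring

theorem summable_smallScale [CompleteSpace V] (hb : IsDriver β σ e M b) (hβ : 0 < β)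
    (hm : 0 < m)
    (hμ : ∀ k, m ≤ μ k) {ε : ℝ} (hε : 0 ≤ ε) (t : ℝ) :
    Summable fun k => (σ k / μ k * FastSlow.expMean (ε / μ k) (b k) t) • e k := by
  refine summable_smul_of_abs_le (K := |t| ^ β / m) hb.orthogonal hb.summable fun k => ?_
  refine hb.abs_div_mul_le hm hμ k ?_
  rw [mul_comm]
  exact hb.abs_expMean_le hβ (div_nonneg hε (hm.le.trans (hμ k))) k t

/-- Averaging does not increase the Hölder constants and `1 / μ k ≤ 1 / m`, so one constant serves
all scales, including `ε = 0`. -/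
theorem norm_smallScale_sub_le [CompleteSpace V] (hb : IsDriver β σ e M b) (hβ : 0 < β)
    (hm : 0 < m)
    (hμ : ∀ k, m ≤ μ k) {ε : ℝ} (hε : 0 ≤ ε) (s t : ℝ) :
    ‖smallScale σ e μ b ε t - smallScale σ e μ b ε s‖
      ≤ m⁻¹ * √(seriesSize σ e M) * |t - s| ^ β := by
  unfold smallScale
  rw [← (hb.summable_smallScale hβ hm hμ hε t).tsum_sub (hb.summable_smallScale hβ hm hμ hε s)]
  simp only [← sub_smul, ← mul_sub]
  refine (norm_tsum_smul_le (K := |t - s| ^ β / m) hb.orthogonal hb.summable (by positivity)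
    fun k => hb.abs_div_mul_le hm hμ k ?_).trans_eq (by ring)
  rw [mul_comm]
  exact (hb.holder k).expMean hβ _ s t

theorem abs_div_sub_div_rpow_le (hm : 0 < m) {μ₀ : ℝ} (hμ : m ≤ μ₀) (ε δ : ℝ) {θ : ℝ}
    (hθ : 0 ≤ θ) : |ε / μ₀ - δ / μ₀| ^ θ ≤ (|ε - δ| / m) ^ θ := by
  refine Real.rpow_le_rpow (abs_nonneg _) ?_ hθ
  rw [← sub_div, abs_div, abs_of_pos (hm.trans_le hμ)]
  gcongr

theorem norm_smallScale_sub_smallScale_le [CompleteSpace V] (hb : IsDriver β σ e M b) (hβ : 0 < β)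
    (hm : 0 < m)
    (hμ : ∀ k, m ≤ μ k) {ε δ : ℝ} (hε : 0 ≤ ε) (hδ : 0 ≤ δ) (t : ℝ) :
    ‖smallScale σ e μ b ε t - smallScale σ e μ b δ t‖
      ≤ Real.Gamma (β + 1) * (|ε - δ| / m) ^ β / m * √(seriesSize σ e M) := by
  have hΓ : 0 < Real.Gamma (β + 1) := Real.Gamma_pos_of_pos (by linarith)
  unfold smallScale
  rw [← (hb.summable_smallScale hβ hm hμ hε t).tsum_sub (hb.summable_smallScale hβ hm hμ hδ t)]
  simp only [← sub_smul, ← mul_sub]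
  refine norm_tsum_smul_le hb.orthogonal hb.summable (by positivity)
    fun k => hb.abs_div_mul_le hm hμ k ?_
  refine ((hb.holder k).abs_expMean_sub_expMean_le hβ _ _ t).trans ?_
  have := (hb.holder k).nonneg
  calc M k * Real.Gamma (β + 1) * |ε / μ k - δ / μ k| ^ β
      ≤ M k * Real.Gamma (β + 1) * (|ε - δ| / m) ^ β := by
        exact mul_le_mul_of_nonneg_left (abs_div_sub_div_rpow_le hm (hμ k) ε δ hβ.le)
          (by positivity)
    _ = _ := by ring

/-- The interpolation estimate is applied in each coordinate with `|ε - δ| / μ k ≤ |ε - δ| / m`.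
Lowering the Hölder exponent in time from `β` to `κ` buys the factor `|ε - δ| ^ (β - κ)`. -/
theorem norm_smallScale_increment_sub_le [CompleteSpace V] (hb : IsDriver β σ e M b) {κ : ℝ} (hκ : 0 < κ)
    (hκβ : κ < β) (hm : 0 < m) (hμ : ∀ k, m ≤ μ k) {ε δ : ℝ} (hε : 0 ≤ ε) (hδ : 0 ≤ δ) (s t : ℝ) :
    ‖(smallScale σ e μ b ε t - smallScale σ e μ b δ t)
        - (smallScale σ e μ b ε s - smallScale σ e μ b δ s)‖
      ≤ 2 * (1 + Real.Gamma (β + 1)) * (|ε - δ| / m) ^ (β - κ) / m * √(seriesSize σ e M)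
        * |t - s| ^ κ := by
  have hβ : 0 < β := hκ.trans hκβ
  have hΓ : 0 < Real.Gamma (β + 1) := Real.Gamma_pos_of_pos (by linarith)
  unfold smallScale
  have h := fun t => (hb.summable_smallScale hβ hm hμ hε t).sub
    (hb.summable_smallScale hβ hm hμ hδ t)
  rw [← (hb.summable_smallScale hβ hm hμ hε t).tsum_sub (hb.summable_smallScale hβ hm hμ hδ t),
    ← (hb.summable_smallScale hβ hm hμ hε s).tsum_sub (hb.summable_smallScale hβ hm hμ hδ s),
    ← (h t).tsum_sub (h s)]
  simp only [← sub_smul, ← mul_sub]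
  refine (norm_tsum_smul_le (K := 2 * (1 + Real.Gamma (β + 1)) * (|ε - δ| / m) ^ (β - κ)
    * |t - s| ^ κ / m) hb.orthogonal hb.summable (by positivity)
    fun k => hb.abs_div_mul_le hm hμ k ?_).trans_eq (by ring)
  refine ((hb.holder k).expMean_sub_expMean hκ hκβ _ _ s t).trans ?_
  have := (hb.holder k).nonneg
  calc 2 * (1 + Real.Gamma (β + 1)) * |ε / μ k - δ / μ k| ^ (β - κ) * M k * |t - s| ^ κ
      ≤ 2 * (1 + Real.Gamma (β + 1)) * (|ε - δ| / m) ^ (β - κ) * M k * |t - s| ^ κ := by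
        gcongr ?_ * _ * _
        gcongr ?_ * ?_
        exact abs_div_sub_div_rpow_le hm (hμ k) ε δ (sub_nonneg.2 hκβ.le)
    _ = _ := by ring

/-- The small scales depend continuously on the time and on the scale. -/
theorem continuous_smallScale [CompleteSpace V] (hb : IsDriver β σ e M b) (hβ : 0 < β)
    (hm : 0 < m)
    (hμ : ∀ k, m ≤ μ k) {s : Set ℝ} (hs : ∀ ε ∈ s, 0 ≤ ε) :
    Continuous fun x : s × ℝ => smallScale σ e μ b x.1 x.2 := by
  refine continuous_iff_continuousAt.2 fun x => ?_
  rw [ContinuousAt, tendsto_iff_norm_sub_tendsto_zero]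
  have h : Continuous fun y : s × ℝ =>
      Real.Gamma (β + 1) * (|(y.1 : ℝ) - x.1| / m) ^ β / m * √(seriesSize σ e M)
        + m⁻¹ * √(seriesSize σ e M) * |y.2 - x.2| ^ β := by
    have h1 : Continuous fun y : s × ℝ => (|(y.1 : ℝ) - x.1| / m) ^ β :=
      (by fun_prop : Continuous fun y : s × ℝ => |(y.1 : ℝ) - x.1| / m).rpow_const
        fun _ => Or.inr hβ.le
    have h2 : Continuous fun y : s × ℝ => |y.2 - x.2| ^ β :=
      (by fun_prop : Continuous fun y : s × ℝ => |y.2 - x.2|).rpow_const fun _ => Or.inr hβ.le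
    fun_prop
  have h0 := h.tendsto x
  simp only [sub_self, abs_zero, zero_div, Real.zero_rpow hβ.ne', mul_zero, zero_mul,
    add_zero] at h0
  refine squeeze_zero (fun _ => norm_nonneg _) (fun y => ?_) h0
  refine (norm_sub_le_norm_sub_add_norm_sub _ (smallScale σ e μ b x.1 y.2) _).trans ?_
  exact add_le_add
    (hb.norm_smallScale_sub_smallScale_le hβ hm hμ (hs _ y.1.2) (hs _ x.1.2) _)
    (hb.norm_smallScale_sub_le hβ hm hμ (hs _ x.1.2) _ _)

theorem summable_driver [CompleteSpace V] (hb : IsDriver β σ e M b) (hβ : 0 < β) (t : ℝ) :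
    Summable fun k => (σ k * b k t) • e k := by
  -- The driving series is the small scale at `ε = 0` with all rates equal to one.
  have h := hb.summable_smallScale (m := 1) (μ := fun _ => 1) hβ one_pos (fun _ => le_rfl) le_rfl t
  simpa [expMean_zero] using h

theorem abs_fluctuation_sub_le (hb : IsDriver β σ e M b) (hβ : 0 < β) (ε : ℝ) (k : ℕ) (s t : ℝ) :
    |σ k * (b k t - FastSlow.expMean (ε / μ k) (b k) t)
      - σ k * (b k s - FastSlow.expMean (ε / μ k) (b k) s)|
      ≤ 2 * |t - s| ^ β * (|σ k| * M k) := by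
  have h1 := hb.holder k s t
  have h2 := (hb.holder k).expMean hβ (ε / μ k) s t
  rw [← mul_sub, abs_mul, sub_sub_sub_comm]
  have h3 := abs_sub (b k t - b k s)
    (FastSlow.expMean (ε / μ k) (b k) t - FastSlow.expMean (ε / μ k) (b k) s)
  calc |σ k| * _ ≤ |σ k| * (M k * |t - s| ^ β + M k * |t - s| ^ β) := by
        gcongr
        linarith
    _ = _ := by ring

theorem abs_fluctuation_le (hb : IsDriver β σ e M b) (hβ : 0 < β) (hm : 0 < m)
    (hμ : ∀ k, m ≤ μ k) {ε : ℝ} (hε : 0 ≤ ε) (k : ℕ) (t : ℝ) :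
    |σ k * (b k t - FastSlow.expMean (ε / μ k) (b k) t)| ≤ 2 * |t| ^ β * (|σ k| * M k) := by
  have h := hb.abs_fluctuation_sub_le (μ := μ) hβ ε k 0 t
  rwa [expMean_of_nonpos (hb.zero k) (div_nonneg hε (hm.le.trans (hμ k))) le_rfl,
    hb.zero k 0 le_rfl, sub_zero, mul_zero, sub_zero, sub_zero] at h

theorem summable_fluctuation [CompleteSpace V] (hb : IsDriver β σ e M b) (hβ : 0 < β)
    (hm : 0 < m)
    (hμ : ∀ k, m ≤ μ k) {ε : ℝ} (hε : 0 ≤ ε) (t : ℝ) :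
    Summable fun k => (σ k * (b k t - FastSlow.expMean (ε / μ k) (b k) t)) • e k :=
  summable_smul_of_abs_le hb.orthogonal hb.summable fun k =>
    hb.abs_fluctuation_le hβ hm hμ hε k t

theorem fluctuation_zero (hb : IsDriver β σ e M b) (hm : 0 < m)
    (hμ : ∀ k, m ≤ μ k) {ε : ℝ} (hε : 0 ≤ ε) : fluctuation σ e μ b ε 0 = 0 := by
  unfold fluctuation
  simp only [fun k => expMean_of_nonpos (hb.zero k) (div_nonneg hε (hm.le.trans (hμ k))) le_rfl,
    fun k => hb.zero k 0 le_rfl, sub_zero, mul_zero, zero_smul, tsum_zero]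

theorem continuous_fluctuation [CompleteSpace V] (hb : IsDriver β σ e M b) (hβ : 0 < β)
    (hm : 0 < m)
    (hμ : ∀ k, m ≤ μ k) {ε : ℝ} (hε : 0 ≤ ε) : Continuous (fluctuation σ e μ b ε) := by
  refine continuous_iff_continuousAt.2 fun s => ?_
  rw [ContinuousAt, tendsto_iff_norm_sub_tendsto_zero]
  have h : Continuous fun t : ℝ => 2 * |t - s| ^ β * √(seriesSize σ e M) := by
    have h2 : Continuous fun t : ℝ => |t - s| ^ β :=
      (by fun_prop : Continuous fun t : ℝ => |t - s|).rpow_const fun _ => Or.inr hβ.le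
    fun_prop
  have h0 := h.tendsto s
  simp only [sub_self, abs_zero, Real.zero_rpow hβ.ne', mul_zero, zero_mul] at h0
  refine squeeze_zero (fun _ => norm_nonneg _) (fun t => ?_) h0
  unfold fluctuation
  rw [← (hb.summable_fluctuation hβ hm hμ hε t).tsum_sub (hb.summable_fluctuation hβ hm hμ hε s)]
  simp only [← sub_smul]
  exact norm_tsum_smul_le hb.orthogonal hb.summable (by positivity)
    fun k => hb.abs_fluctuation_sub_le hβ ε k s t

/-- In coordinate `k` the integral of `b - K_τ b` is `τ K_τ b` with `τ = ε / μ k`, which accounts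
for both the factor `ε` and the division by `μ k` in `smallScale`. -/
theorem integral_fluctuation [CompleteSpace V] (hb : IsDriver β σ e M b) (hβ : 0 < β)
    (hm : 0 < m)
    (hμ : ∀ k, m ≤ μ k) {ε t : ℝ} (hε : 0 < ε) (ht : 0 ≤ t) :
    ∫ r in (0 : ℝ)..t, fluctuation σ e μ b ε r = ε • smallScale σ e μ b ε t := by
  have hτ : ∀ k, 0 < ε / μ k := fun k => div_pos hε (hm.trans_le (hμ k))
  have hc : ∀ k, Continuous fun r => σ k * (b k r - FastSlow.expMean (ε / μ k) (b k) r) :=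
    fun k => continuous_const.mul (((hb.holder k).continuous hβ).sub
      (((hb.holder k).expMean hβ _).continuous hβ))
  -- Partial sums are bounded uniformly in `n` on `[0, t]` by orthogonality, so dominated
  -- convergence permits integration term by term.
  have h1 : Tendsto (fun n : ℕ => ∫ r in (0 : ℝ)..t, ∑ k ∈ Finset.range n,
      (σ k * (b k r - FastSlow.expMean (ε / μ k) (b k) r)) • e k) atTop
      (𝓝 (∫ r in (0 : ℝ)..t, fluctuation σ e μ b ε r)) := by
    refine intervalIntegral.tendsto_integral_filter_of_dominated_convergence
      (fun _ => 2 * t ^ β * √(seriesSize σ e M)) (Eventually.of_forall fun n => ?_)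
      (Eventually.of_forall fun n => Eventually.of_forall fun r hr => ?_)
      intervalIntegrable_const (Eventually.of_forall fun r _ => ?_)
    · exact (continuous_finsetSum _ fun k _ =>
        (hc k).smul continuous_const).aestronglyMeasurable
    · rw [uIoc_of_le ht] at hr
      refine norm_sum_smul_le hb.orthogonal hb.summable (by positivity) (fun k => ?_) _
      refine (hb.abs_fluctuation_le hβ hm hμ hε.le k r).trans ?_
      have := (hb.holder k).nonneg
      rw [abs_of_pos hr.1]
      gcongr
      · exact hr.1.le
      · exact hr.2
    · exact (hb.summable_fluctuation hβ hm hμ hε.le r).hasSum.tendsto_sum_nat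
  have h2 := ((hb.summable_smallScale hβ hm hμ hε.le t).hasSum.const_smul ε).tendsto_sum_nat
  refine tendsto_nhds_unique h1 (h2.congr fun n => ?_)
  have hi : ∀ k ∈ Finset.range n, IntervalIntegrable
      (fun r => (σ k * (b k r - FastSlow.expMean (ε / μ k) (b k) r)) • e k) volume 0 t :=
    fun k _ => ((hc k).smul continuous_const).intervalIntegrable _ _
  rw [intervalIntegral.integral_finsetSum hi]
  refine Finset.sum_congr rfl fun k _ => ?_
  rw [intervalIntegral.integral_smul_const, intervalIntegral.integral_const_mul,
    integral_sub_expMean (hb.zero k) ((hb.holder k).continuous hβ) (hτ k) ht, smul_smul]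
  congr 1
  ring

end IsDriver

end OrthogonalSeries

/-! ### Pathwise solution of the equation for the small scales -/

section OUPath

/-- Finite combinations of eigenvectors lie in the graph; since both the series and its formal image
converge, the closed graph contains the limit. -/
theorem map_mem_graph_of_hasSum {V H : Type*} [NormedAddCommGroup V] [NormedSpace ℝ V]
    [NormedAddCommGroup H] [NormedSpace ℝ H] (L : V →L[ℝ] H) {C : H →ₗ.[ℝ] H} (hC : C.IsClosed)
    {e : ℕ → V} {lam : ℕ → ℝ} (he : ∀ k, (L (e k), lam k • L (e k)) ∈ C.graph)
    {c c' : ℕ → ℝ} (hc : ∀ k, c' k = c k * lam k) {x y : V} (hx : HasSum (fun k => c k • e k) x)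
    (hy : HasSum (fun k => c' k • e k) y) : (L x, L y) ∈ C.graph := by
  refine IsClosed.mem_of_tendsto hC
    (((L.continuous.tendsto x).comp hx.tendsto_sum_nat).prodMk_nhds
      ((L.continuous.tendsto y).comp hy.tendsto_sum_nat)) (Eventually.of_forall fun n => ?_)
  have h : (L (∑ k ∈ Finset.range n, c k • e k), L (∑ k ∈ Finset.range n, c' k • e k))
      = ∑ k ∈ Finset.range n, c k • (L (e k), lam k • L (e k)) := by
    simp [Prod.ext_iff, Prod.fst_sum, Prod.snd_sum, smul_smul, hc]
  simp only [Function.comp_apply, h]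
  exact Submodule.sum_mem _ fun k _ => Submodule.smul_mem _ _ (he k)

theorem inner_smul_nonpos {H : Type*} [NormedAddCommGroup H] [InnerProductSpace ℝ H] {x y : H}
    {a : ℝ} (ha : 0 ≤ a) (hxy : inner ℝ x y ≤ 0) : inner ℝ x (a • y) ≤ 0 := by
  rw [real_inner_smul_right]
  exact mul_nonpos_of_nonneg_of_nonpos ha hxy

/-- The squared norm has derivative `2 ⟨X, U⟩ ≤ 0` and starts at zero. -/
theorem eq_zero_of_inner_deriv_nonpos {H : Type*} [NormedAddCommGroup H] [InnerProductSpace ℝ H]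
    {X U : ℝ → H} {T : ℝ} (hX : ∀ t, HasDerivAt X (U t) t) (h0 : X 0 = 0)
    (hXU : ∀ t ∈ Icc 0 T, inner ℝ (X t) (U t) ≤ 0) {t : ℝ} (ht : t ∈ Icc 0 T) : X t = 0 := by
  have hgd : ∀ t, HasDerivAt (fun t => inner ℝ (X t) (X t)) (2 * inner ℝ (X t) (U t)) t := by
    intro t
    refine ((hX t).inner ℝ (hX t)).congr_deriv ?_
    rw [real_inner_comm (X t) (U t)]
    ring
  have hanti : AntitoneOn (fun t => inner ℝ (X t) (X t)) (Icc 0 T) := by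
    refine antitoneOn_of_deriv_nonpos (convex_Icc 0 T)
      (fun t _ => (hgd t).continuousAt.continuousWithinAt)
      (fun t _ => (hgd t).differentiableAt.differentiableWithinAt) fun t ht => ?_
    rw [(hgd t).deriv]
    have := hXU t (interior_subset ht)
    linarith
  have h1 := hanti (left_mem_Icc.2 (ht.1.trans ht.2)) ht ht.1
  simp only [h0, inner_zero_left] at h1
  exact inner_self_eq_zero.1 (le_antisymm h1 real_inner_self_nonneg)

variable {d : ℕ} {ξ : ℝ}

/-- The bounded inclusion of `H^s` into `H`. -/
def inclL (d : ℕ) {s : ℝ} (hs : 0 ≤ s) : Sobolev d s →L[ℝ] HSpace d :=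
  LinearMap.mkContinuousOfExistsBound Sobolev.incl (exists_norm_incl_le d hs)

theorem inclL_apply {s : ℝ} (hs : 0 ≤ s) (v : Sobolev d s) : inclL d hs v = Sobolev.incl v := rfl

variable {C : HSpace d →ₗ.[ℝ] HSpace d} {e : ℕ → Sobolev d ξ} {σ lam : ℕ → ℝ} {γ h ε T : ℝ}

theorem IsFriction.inner_nonpos (hC : IsFriction C e lam γ) (x : C.domain) :
    inner ℝ (x : HSpace d) (C x) ≤ 0 := by
  obtain ⟨c, hc, hx⟩ := hC.coercive
  obtain ⟨v, -, hv⟩ := hx x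
  have : 0 ≤ c * ‖v‖ ^ 2 := by positivity
  linarith

theorem IsFriction.neg_lam_ge (hC : IsFriction C e lam γ) (k : ℕ) : -lam 0 ≤ -lam k :=
  neg_le_neg (hC.lam_le k)

/-- By coercivity of the friction, the equation has at most one solution. -/
theorem IsOUPath.unique (hξ : 0 ≤ ξ) (hC : IsFriction C e lam γ) (hT : 0 < T) (hε : 0 < ε)
    {W w w' : ℝ → Sobolev d ξ} (hw : IsOUPath C h ε T W w) (hw' : IsOUPath C h ε T W w') :
    EqOn w w' (Icc 0 T) := by
  set u : ℝ → HSpace d := fun t => Sobolev.incl (w t) - Sobolev.incl (w' t) with hu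
  have hincl : Continuous (Sobolev.incl : Sobolev d ξ → HSpace d) := (inclL d hξ).continuous
  have hc1 : ContinuousOn (fun t => Sobolev.incl (w t)) (Icc 0 T) :=
    hincl.comp_continuousOn hw.continuousOn
  have hc2 : ContinuousOn (fun t => Sobolev.incl (w' t)) (Icc 0 T) :=
    hincl.comp_continuousOn hw'.continuousOn
  -- Extending the difference by its endpoint values makes its primitive `X` differentiable at every
  -- time. On `[0, T]` it satisfies `X' = ε⁻¹ C X`, to which the energy argument applies.
  set U : ℝ → HSpace d := IccExtend hT.le ((Icc 0 T).domRestrict u) with hU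
  have hUc : Continuous U := (continuousOn_iff_continuous_domRestrict.1 (hc1.sub hc2)).Icc_extend'
  have hUu : ∀ t ∈ Icc 0 T, U t = u t := fun t ht => IccExtend_of_mem _ _ ht
  set X : ℝ → HSpace d := fun t => ∫ r in (0 : ℝ)..t, U r with hX
  have hXd : ∀ t, HasDerivAt X (U t) t := fun t => (hUc.integral_hasStrictDerivAt 0 t).hasDerivAt
  have hdom : ∀ t ∈ Icc 0 T, ∃ x : C.domain, (x : HSpace d) = X t ∧ U t = ε⁻¹ • C x := by
    intro t ht
    obtain ⟨x, hx, hx'⟩ := hw.equation t ht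
    obtain ⟨y, hy, hy'⟩ := hw'.equation t ht
    have hsub : Icc 0 t ⊆ Icc 0 T := Icc_subset_Icc_right ht.2
    refine ⟨x - y, ?_, ?_⟩
    · rw [Submodule.coe_sub, hx, hy, ← intervalIntegral.integral_sub
        ((hc1.mono hsub).intervalIntegrable_of_Icc ht.1)
        ((hc2.mono hsub).intervalIntegrable_of_Icc ht.1)]
      refine intervalIntegral.integral_congr fun r hr => ?_
      rw [uIcc_of_le ht.1] at hr
      exact (hUu r (hsub hr)).symm
    · rw [hUu t ht, hu, LinearPMap.map_sub, smul_sub]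
      simp only [hx', hy']
      abel
  intro t ht
  have hX0 : X t = 0 := by
    refine eq_zero_of_inner_deriv_nonpos hXd intervalIntegral.integral_same (fun r hr => ?_) ht
    obtain ⟨x, hx, hx'⟩ := hdom r hr
    rw [hx', ← hx]
    exact inner_smul_nonpos (inv_pos.2 hε).le (hC.inner_nonpos x)
  -- The difference of the solutions itself is `ε⁻¹ C X`, so it vanishes together with its primitive
  -- `X`.
  obtain ⟨x, hx, hx'⟩ := hdom t ht
  have hx0 : x = 0 := Subtype.ext (hx.trans hX0)
  rw [hx0, LinearPMap.map_zero, smul_zero, hUu t ht] at hx'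
  exact Sobolev.incl_injective (sub_eq_zero.1 hx')

variable [CompleteSpace (Sobolev d ξ)] {β : ℝ} {M : ℕ → ℝ} {b : ℕ → ℝ → ℝ}

/-- The solution of the equation for the small scales. -/
def ouSolution (σ : ℕ → ℝ) (e : ℕ → Sobolev d ξ) (lam : ℕ → ℝ) (b : ℕ → ℝ → ℝ) (h ε t : ℝ) :
    Sobolev d ξ :=
  ε ^ (-h) • fluctuation σ e (fun k => -lam k) b ε t

/-- As `lam k = -μ k`, applying `C` to `(σ / μ) K b` gives `-σ K b = σ (b - K b) - σ b` in each
coordinate. For `ε > 0` this is the equation for the small scales; for `ε = 0` the fluctuation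
vanishes and it says that `-C` maps the limit to the noise. -/
theorem IsDriver.smallScale_mem_graph (hξ : 0 ≤ ξ) (hC : IsFriction C e lam γ)
    (hb : IsDriver β σ e M b) (hβ : 0 < β) (hε : 0 ≤ ε) (t : ℝ) :
    (Sobolev.incl (smallScale σ e (fun k => -lam k) b ε t),
      Sobolev.incl (fluctuation σ e (fun k => -lam k) b ε t)
        - Sobolev.incl (∑' k, (σ k * b k t) • e k)) ∈ C.graph := by
  have hm : 0 < -lam 0 := neg_pos.2 hC.lam_neg
  have h1 := hb.summable_smallScale hβ hm hC.neg_lam_ge hε t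
  have h2 := hb.summable_fluctuation hβ hm hC.neg_lam_ge hε t
  have h3 := hb.summable_driver hβ t
  have h4 := map_mem_graph_of_hasSum (inclL d hξ) hC.closed hC.eigen (fun k => ?_) h1.hasSum
    (c' := fun k => σ k * (b k t - FastSlow.expMean (ε / -lam k) (b k) t) - σ k * b k t)
    (by simpa only [sub_smul] using h2.hasSum.sub h3.hasSum)
  · rwa [map_sub] at h4
  · have hk : lam k ≠ 0 := ((hC.lam_le k).trans_lt hC.lam_neg).ne
    field_simp
    ring

theorem IsDriver.isOUPath (hξ : 0 ≤ ξ) (hC : IsFriction C e lam γ)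
    (hb : IsDriver β σ e M b) (hβ : 0 < β) (hε : 0 < ε) {W : ℝ → Sobolev d ξ}
    (hW : ∀ t ∈ Icc 0 T, W t = ∑' k, (σ k * b k t) • e k) :
    IsOUPath C h ε T W (ouSolution σ e lam b h ε) := by
  have hm : 0 < -lam 0 := neg_pos.2 hC.lam_neg
  have hc := hb.continuous_fluctuation hβ hm hC.neg_lam_ge hε.le
  refine ⟨(hc.const_smul (ε ^ (-h))).continuousOn, ?_, fun t ht => ?_⟩
  · rw [ouSolution, hb.fluctuation_zero hm hC.neg_lam_ge hε.le, smul_zero]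
  · obtain ⟨x, hx, hx'⟩ := (LinearPMap.mem_graph_iff C).1
      (hb.smallScale_mem_graph hξ hC hβ hε.le t)
    simp only at hx hx'
    refine ⟨(ε ^ (-h) * ε) • x, ?_, ?_⟩
    · have h1 : ∫ r in (0 : ℝ)..t, Sobolev.incl (ouSolution σ e lam b h ε r)
          = inclL d hξ (∫ r in (0 : ℝ)..t, ouSolution σ e lam b h ε r) :=
        (inclL d hξ).intervalIntegral_comp_comm
          ((hc.const_smul (ε ^ (-h))).intervalIntegrable _ _)
      rw [h1]
      simp only [ouSolution]
      rw [intervalIntegral.integral_smul, hb.integral_fluctuation hβ hm hC.neg_lam_ge hε ht.1,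
        map_smul, map_smul, inclL_apply, ← hx, smul_smul, Submodule.coe_smul]
    · rw [LinearPMap.map_smul, hx', hW t ht, ouSolution, map_smul, smul_smul]
      rw [show ε⁻¹ * (ε ^ (-h) * ε) = ε ^ (-h) by field_simp, smul_sub]
      abel

/-- By uniqueness the given solution is the explicit one, and the powers of `ε` cancel: `ε^{-1+h}
ε^{-h} ε = 1`. -/
theorem IsDriver.integratedOU_eq {Ω : Type*} (hξ : 0 ≤ ξ) (hC : IsFriction C e lam γ)
    (hb : IsDriver β σ e M b) (hβ : 0 < β) (hT : 0 < T) (hε : 0 < ε) {W : ℝ → Sobolev d ξ}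
    (hW : ∀ t ∈ Icc 0 T, W t = ∑' k, (σ k * b k t) • e k) {w : ℝ → Ω → Sobolev d ξ} {ω : Ω}
    (hw : IsOUPath C h ε T W fun t => w t ω) {t : ℝ} (ht : t ∈ Icc 0 T) :
    integratedOU 1 h ε w t ω = smallScale σ e (fun k => -lam k) b ε t := by
  have hm : 0 < -lam 0 := neg_pos.2 hC.lam_neg
  have h1 := hw.unique hξ hC hT hε (hb.isOUPath hξ hC hβ hε hW)
  have h2 : ∫ r in (0 : ℝ)..t, ε ^ (-1 + h) • w r ω
      = ∫ r in (0 : ℝ)..t, ε ^ (-1 + h) • ouSolution σ e lam b h ε r := by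
    refine intervalIntegral.integral_congr fun r hr => ?_
    rw [uIcc_of_le ht.1] at hr
    exact congrArg _ (h1 ⟨hr.1, hr.2.trans ht.2⟩)
  rw [integratedOU, h2]
  simp only [ouSolution, smul_smul]
  rw [intervalIntegral.integral_smul, hb.integral_fluctuation hβ hm hC.neg_lam_ge hε ht.1,
    smul_smul, ← Real.rpow_add hε]
  rw [show -1 + h + -h = (-1 : ℝ) by ring, Real.rpow_neg_one, inv_mul_cancel₀ hε.ne', one_smul]

end OUPath

/-! ### Hölder constants from dyadic increments -/

section Dyadic

/-- The `i`-th dyadic point of level `n` of the interval `[0, T]`. -/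
def dyadicNode (T : ℝ) (n i : ℕ) : ℝ := T * i / 2 ^ n

/-- The index of the last dyadic point of level `n` before `t`. -/
def dyadicIndex (T : ℝ) (n : ℕ) (t : ℝ) : ℕ := ⌊2 ^ n * (t / T)⌋₊

variable {T t : ℝ}

theorem dyadicIndex_le (hT : 0 < T) (ht : t ∈ Icc 0 T) (n : ℕ) : dyadicIndex T n t ≤ 2 ^ n := by
  have h : t / T ≤ 1 := (div_le_one hT).2 ht.2
  have h2 : (2 : ℝ) ^ n * (t / T) ≤ ((2 ^ n : ℕ) : ℝ) := by
    push_cast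
    exact mul_le_of_le_one_right (by positivity) h
  exact Nat.floor_le_of_le h2

theorem dyadicNode_mem (hT : 0 < T) {n i : ℕ} (hi : i ≤ 2 ^ n) : dyadicNode T n i ∈ Icc 0 T := by
  have h : (i : ℝ) ≤ 2 ^ n := by exact_mod_cast hi
  unfold dyadicNode
  exact ⟨by positivity, by rw [div_le_iff₀ (by positivity)]; gcongr⟩

theorem tendsto_dyadicNode (hT : 0 < T) (ht : t ∈ Icc 0 T) :
    Tendsto (fun n => dyadicNode T n (dyadicIndex T n t)) atTop (𝓝 t) := by
  have h0 : Tendsto (fun n : ℕ => t - T * (1 / 2) ^ n) atTop (𝓝 t) := by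
    have := (tendsto_pow_atTop_nhds_zero_of_lt_one (r := (1 / 2 : ℝ)) (by norm_num)
      (by norm_num)).const_mul T
    simpa using this.const_sub t
  refine tendsto_of_tendsto_of_tendsto_of_le_of_le h0 tendsto_const_nhds (fun n => ?_) fun n => ?_
  · have h1 := Nat.lt_floor_add_one ((2 : ℝ) ^ n * (t / T))
    have h2 : (2 : ℝ) ^ n * t < (dyadicIndex T n t + 1) * T := by
      have h3 := mul_lt_mul_of_pos_right h1 hT
      rwa [mul_assoc, div_mul_cancel₀ t hT.ne'] at h3
    simp only [dyadicNode, one_div, inv_pow]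
    rw [sub_le_iff_le_add, ← div_eq_mul_inv, ← add_div, le_div_iff₀ (by positivity)]
    linarith
  · have h1 := Nat.floor_le (a := (2 : ℝ) ^ n * (t / T))
      (mul_nonneg (by positivity) (div_nonneg ht.1 hT.le))
    have h3 := mul_le_mul_of_nonneg_right h1 hT.le
    rw [mul_assoc, div_mul_cancel₀ t hT.ne'] at h3
    simp only [dyadicNode]
    rw [div_le_iff₀ (by positivity), mul_comm T, mul_comm t]
    exact h3

variable {β N : ℝ} {f : ℝ → ℝ}

/-- Passing to the next level doubles the index of `t`, possibly plus one, so the approximating node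
moves by at most one interval of the finer grid. -/
theorem abs_dyadic_succ_sub_le (hT : 0 < T) (hN : 0 ≤ N) {ρ : ℝ} (hρ : 0 ≤ ρ)
    (hf : ∀ n, ∀ i < 2 ^ n, |f (dyadicNode T n (i + 1)) - f (dyadicNode T n i)| ≤ N * ρ ^ n)
    (ht : t ∈ Icc 0 T) (n : ℕ) :
    dist (f (dyadicNode T n (dyadicIndex T n t)))
      (f (dyadicNode T (n + 1) (dyadicIndex T (n + 1) t))) ≤ N * ρ * ρ ^ n := by
  have hx : 0 ≤ (2 : ℝ) ^ n * (t / T) := mul_nonneg (by positivity) (div_nonneg ht.1 hT.le)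
  have h1 := Nat.floor_le hx
  have h2 := Nat.lt_floor_add_one ((2 : ℝ) ^ n * (t / T))
  have hx' : (2 : ℝ) ^ (n + 1) * (t / T) = 2 * (2 ^ n * (t / T)) := by ring
  have hlo : 2 * dyadicIndex T n t ≤ dyadicIndex T (n + 1) t := by
    refine Nat.le_floor ?_
    rw [hx']
    push_cast
    unfold dyadicIndex
    linarith
  have hhi : dyadicIndex T (n + 1) t < 2 * dyadicIndex T n t + 2 := by
    refine (Nat.floor_lt (by rw [hx']; linarith)).2 ?_
    rw [hx']
    push_cast
    unfold dyadicIndex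
    linarith
  have hnode : dyadicNode T n (dyadicIndex T n t) = dyadicNode T (n + 1) (2 * dyadicIndex T n t) := by
    unfold dyadicNode
    push_cast
    rw [pow_succ]
    field_simp
  rw [hnode]
  rcases (by omega : dyadicIndex T (n + 1) t = 2 * dyadicIndex T n t ∨
    dyadicIndex T (n + 1) t = 2 * dyadicIndex T n t + 1) with h | h
  · rw [h, dist_self]
    positivity
  · have hle := dyadicIndex_le hT ht (n + 1)
    rw [h] at hle ⊢
    rw [dist_comm, Real.dist_eq]
    refine (hf (n + 1) _ hle).trans_eq ?_
    ring

/-- A constant by which dyadic increments control the Hölder constant. -/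
def dyadicConst (β T : ℝ) : ℝ :=
  (1 + 2 * ((1 / 2) ^ β / (1 - (1 / 2) ^ β))) * (2 / T) ^ β

theorem half_rpow_lt_one (hβ : 0 < β) : (1 / 2 : ℝ) ^ β < 1 :=
  Real.rpow_lt_one (by norm_num) (by norm_num) hβ

theorem dyadicConst_nonneg (hβ : 0 < β) (hT : 0 < T) : 0 ≤ dyadicConst β T := by
  have h1 : 0 ≤ 1 - (1 / 2 : ℝ) ^ β := sub_nonneg.2 (half_rpow_lt_one hβ).le
  unfold dyadicConst
  positivity

/-- Chaining: `f t` and `f s` are reached from their nodes of level `n` by geometric series, and at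
the level matching `t - s` these two nodes coincide or are neighbours. -/
theorem abs_sub_le_of_dyadic (hT : 0 < T) (hβ : 0 < β) (hN : 0 ≤ N) (hc : ContinuousOn f (Icc 0 T))
    (hf : ∀ n, ∀ i < 2 ^ n,
      |f (dyadicNode T n (i + 1)) - f (dyadicNode T n i)| ≤ N * ((1 / 2 : ℝ) ^ β) ^ n)
    {s : ℝ} (hs : s ∈ Icc 0 T) (ht : t ∈ Icc 0 T) :
    |f t - f s| ≤ dyadicConst β T * N * |t - s| ^ β := by
  wlog hst : s ≤ t generalizing s t
  · rw [abs_sub_comm, abs_sub_comm t s]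
    exact this ht hs (le_of_not_ge hst)
  rcases hst.eq_or_lt with rfl | hst
  · simp [Real.zero_rpow hβ.ne']
  set ρ : ℝ := (1 / 2 : ℝ) ^ β with hρ
  have hρ0 : 0 < ρ := by positivity
  have hρ1 : ρ < 1 := half_rpow_lt_one hβ
  have hlim : ∀ x ∈ Icc 0 T, ∀ n, |f (dyadicNode T n (dyadicIndex T n x)) - f x|
      ≤ N * ρ * ρ ^ n / (1 - ρ) := by
    intro x hx n
    refine dist_le_of_le_geometric_of_tendsto ρ (N * ρ) hρ1
      (abs_dyadic_succ_sub_le hT hN hρ0.le hf hx) ?_ n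
    have h1 := (hc x hx).tendsto
    refine h1.comp (tendsto_nhdsWithin_iff.2 ⟨tendsto_dyadicNode hT hx,
      Eventually.of_forall fun n => dyadicNode_mem hT (dyadicIndex_le hT hx n)⟩)
  -- The level satisfies `2^{-(n+1)} < (t - s) / T ≤ 2^{-n}`: the upper bound makes the nodes
  -- adjacent, the lower one turns `ρ ^ n` into a multiple of `|t - s| ^ β`.
  obtain ⟨n, hn1, hn2⟩ := exists_nat_pow_near_of_lt_one (x := (t - s) / T) (y := (1 / 2 : ℝ))
    (div_pos (sub_pos.2 hst) hT) ((div_le_one hT).2 (by linarith [ht.2, hs.1]))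
    (by norm_num) (by norm_num)
  have hadj : |f (dyadicNode T n (dyadicIndex T n t)) - f (dyadicNode T n (dyadicIndex T n s))|
      ≤ N * ρ ^ n := by
    have hdiff : (2 : ℝ) ^ n * (t / T) ≤ 2 ^ n * (s / T) + 1 := by
      have h1 : (2 : ℝ) ^ n * ((t - s) / T) ≤ 2 ^ n * (1 / 2) ^ n := by gcongr
      rw [← mul_pow] at h1
      norm_num at h1
      rw [sub_div, mul_sub] at h1
      linarith
    have hlo : dyadicIndex T n s ≤ dyadicIndex T n t := by
      unfold dyadicIndex
      gcongr
    have hhi : dyadicIndex T n t < dyadicIndex T n s + 2 := by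
      refine (Nat.floor_lt (mul_nonneg (by positivity) (div_nonneg ht.1 hT.le))).2 ?_
      have h2 := Nat.lt_floor_add_one ((2 : ℝ) ^ n * (s / T))
      push_cast
      unfold dyadicIndex
      linarith
    rcases (by omega : dyadicIndex T n t = dyadicIndex T n s ∨
      dyadicIndex T n t = dyadicIndex T n s + 1) with h | h
    · rw [h, sub_self, abs_zero]
      positivity
    · have hle := dyadicIndex_le hT ht n
      rw [h] at hle ⊢
      exact hf n _ hle
  have h1 : |f t - f s| ≤ N * ρ ^ n * (1 + 2 * (ρ / (1 - ρ))) := by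
    have h2 := hlim t ht n
    have h3 := hlim s hs n
    rw [abs_sub_comm] at h2
    have h4 := abs_add_le (f t - f (dyadicNode T n (dyadicIndex T n t)))
      (f (dyadicNode T n (dyadicIndex T n t)) - f (dyadicNode T n (dyadicIndex T n s)))
    have h5 := abs_add_le (f t - f (dyadicNode T n (dyadicIndex T n s)))
      (f (dyadicNode T n (dyadicIndex T n s)) - f s)
    rw [sub_add_sub_cancel] at h4 h5
    calc |f t - f s| ≤ N * ρ * ρ ^ n / (1 - ρ) + N * ρ ^ n + N * ρ * ρ ^ n / (1 - ρ) := by linarith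
      _ = _ := by ring
  have h2 : ρ ^ n ≤ (2 / T) ^ β * |t - s| ^ β := by
    rw [hρ, ← Real.mul_rpow (by positivity) (abs_nonneg _), ← Real.rpow_natCast,
      ← Real.rpow_mul (by norm_num), mul_comm β, Real.rpow_mul (by norm_num), Real.rpow_natCast]
    refine Real.rpow_le_rpow (by positivity) ?_ hβ.le
    rw [abs_of_pos (sub_pos.2 hst)]
    rw [pow_succ] at hn1
    calc (1 / 2 : ℝ) ^ n ≤ 2 * ((t - s) / T) := by linarith
      _ = _ := by ring
  have h3 : 0 ≤ 1 + 2 * (ρ / (1 - ρ)) := by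
    have : 0 ≤ 1 - ρ := by linarith
    positivity
  refine h1.trans ?_
  calc N * ρ ^ n * (1 + 2 * (ρ / (1 - ρ)))
      ≤ N * ((2 / T) ^ β * |t - s| ^ β) * (1 + 2 * (ρ / (1 - ρ))) := by gcongr
    _ = _ := by
      unfold dyadicConst
      ring

end Dyadic

/-! ### Fractional Brownian motion -/

section FBM

variable {Ω : Type*} [MeasurableSpace Ω] {P : Measure Ω} {h : ℝ} {X : ℝ≥0 → Ω → ℝ}

theorem IsFBM.memLp (hX : IsFBM h X P) (t : ℝ≥0) : MemLp (X t) 2 P :=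
  (hX.gaussian.hasGaussianLaw_eval t).memLp (by simp)

theorem IsFBM.integral_sub_sq [IsProbabilityMeasure P] (hX : IsFBM h X P) (hh : 0 < h)
    (s t : ℝ≥0) : ∫ ω, (X t ω - X s ω) ^ 2 ∂P = |(t : ℝ) - s| ^ (2 * h) := by
  have hi : ∀ s t, Integrable (fun ω => X s ω * X t ω) P :=
    fun s t => (hX.memLp s).integrable_mul (hX.memLp t)
  have h1 : ∀ ω, (X t ω - X s ω) ^ 2 = X t ω * X t ω - 2 * (X s ω * X t ω) + X s ω * X s ω :=
    fun ω => by ring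
  simp only [h1]
  have hsub : Integrable (fun ω => X t ω * X t ω - 2 * (X s ω * X t ω)) P :=
    (hi t t).sub ((hi s t).const_mul 2)
  rw [integral_add hsub (hi s s), integral_sub (hi t t) ((hi s t).const_mul 2), integral_const_mul, hX.cov, hX.cov, hX.cov]
  simp only [sub_self, abs_zero, Real.zero_rpow (by linarith : 2 * h ≠ 0)]
  ring

theorem IsFBM.ae_zero [IsProbabilityMeasure P] (hX : IsFBM h X P) (hh : 0 < h) :
    ∀ᵐ ω ∂P, X 0 ω = 0 := by
  have h1 := hX.cov 0 0
  simp only [NNReal.coe_zero, sub_self, abs_zero, Real.zero_rpow (by linarith : 2 * h ≠ 0),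
    add_zero, zero_div] at h1
  have h2 := (integral_eq_zero_iff_of_nonneg (fun ω => mul_self_nonneg (X 0 ω))
    ((hX.memLp 0).integrable_mul (hX.memLp 0))).1 h1
  filter_upwards [h2] with ω hω
  exact mul_self_eq_zero.1 hω

/-- The increment is a centred Gaussian with variance `|t - s| ^ (2h)`, so it is a rescaled standard
one. This gives all its absolute moments by scaling. -/
theorem IsFBM.map_sub [IsProbabilityMeasure P] (hX : IsFBM h X P) (hh : 0 < h) (s t : ℝ≥0) :
    P.map (fun ω => X t ω - X s ω)
      = (gaussianReal 0 1).map fun x => |(t : ℝ) - s| ^ h * x := by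
  have hi : ∀ t, Integrable (X t) P := fun t => (hX.memLp t).integrable (by norm_num)
  have hmean : ∫ ω, (X t ω - X s ω) ∂P = 0 := by
    rw [integral_sub (hi t) (hi s), hX.mean, hX.mean, sub_zero]
  have hvar : Var[fun ω => X t ω - X s ω; P] = (|(t : ℝ) - s| ^ h) ^ 2 := by
    have hm : AEMeasurable (fun ω => X t ω - X s ω) P :=
      (hX.gaussian.aemeasurable t).sub (hX.gaussian.aemeasurable s)
    rw [variance_eq_integral hm, hmean]
    simp only [sub_zero]
    rw [hX.integral_sub_sq hh s t, mul_comm, Real.rpow_mul (abs_nonneg _), Real.rpow_two]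
  rw [(hX.gaussian.hasGaussianLaw_fun_sub (s := t) (t := s)).map_eq_gaussianReal, hmean, hvar,
    gaussianReal_map_const_mul, mul_zero, mul_one]
  congr 1
  ext
  simp [Real.coe_toNNReal _ (sq_nonneg (|(t : ℝ) - s| ^ h))]

/-- The absolute moments of the standard Gaussian law. -/
def gaussianMoment (r : ℝ) : ℝ≥0∞ := ∫⁻ x, ‖x‖ₑ ^ r ∂(gaussianReal 0 1)

theorem gaussianMoment_lt_top {r : ℝ} (hr : 0 < r) : gaussianMoment r < ⊤ := by
  have h1 := (memLp_id_gaussianReal (μ := 0) (v := 1) r.toNNReal).eLpNorm_lt_top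
  have h2 := lintegral_rpow_enorm_lt_top_of_eLpNorm_lt_top (by simpa using hr)
    ENNReal.coe_ne_top h1
  simpa [gaussianMoment, Real.coe_toNNReal r hr.le] using h2

theorem IsFBM.lintegral_sub_rpow [IsProbabilityMeasure P] (hX : IsFBM h X P) (hh : 0 < h)
    {r : ℝ} (hr : 0 < r) (s t : ℝ≥0) :
    ∫⁻ ω, ‖X t ω - X s ω‖ₑ ^ r ∂P
      = ENNReal.ofReal (|(t : ℝ) - s| ^ (h * r)) * gaussianMoment r := by
  have hm : AEMeasurable (fun ω => X t ω - X s ω) P :=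
    (hX.gaussian.aemeasurable t).sub (hX.gaussian.aemeasurable s)
  have h1 : ∫⁻ ω, ‖X t ω - X s ω‖ₑ ^ r ∂P
      = ∫⁻ x, ‖x‖ₑ ^ r ∂(P.map fun ω => X t ω - X s ω) :=
    (lintegral_map' (f := fun x : ℝ => ‖x‖ₑ ^ r) (by fun_prop) hm).symm
  rw [h1, hX.map_sub hh, lintegral_map (by fun_prop) (by fun_prop)]
  have h2 : ∀ x : ℝ, ‖|(t : ℝ) - s| ^ h * x‖ₑ ^ r
      = ENNReal.ofReal (|(t : ℝ) - s| ^ (h * r)) * ‖x‖ₑ ^ r := fun x => by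
    rw [enorm_mul, ENNReal.mul_rpow_of_nonneg _ _ hr.le,
      Real.enorm_eq_ofReal (Real.rpow_nonneg (abs_nonneg _) _),
      ENNReal.ofReal_rpow_of_nonneg (Real.rpow_nonneg (abs_nonneg _) _) hr.le,
      ← Real.rpow_mul (abs_nonneg _)]
  simp only [h2]
  rw [lintegral_const_mul _ (by fun_prop)]
  rfl

end FBM

/-! ### Moments of the Hölder constants of the noise -/

section Driver

/-- Jensen's inequality for weights that are not normalised. -/
theorem tsum_mul_rpow_le {w z : ℕ → ℝ≥0∞} {p : ℝ} (hp : 1 ≤ p) :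
    (∑' k, w k * z k) ^ p ≤ (∑' k, w k) ^ (p - 1) * ∑' k, w k * z k ^ p := by
  have hp0 : 0 < p := zero_lt_one.trans_le hp
  have h1 : ∑' k, w k * z k ≤ (∑' k, w k) ^ (1 - p⁻¹) * (∑' k, w k * z k ^ p) ^ p⁻¹ := by
    refine ENNReal.tsum_le_of_sum_range_le fun n => ?_
    refine (ENNReal.inner_le_weight_mul_Lp_of_nonneg _ hp w z).trans ?_
    have h2 : 0 ≤ 1 - p⁻¹ := sub_nonneg.2 (inv_le_one_of_one_le₀ hp)
    exact mul_le_mul' (ENNReal.rpow_le_rpow (ENNReal.sum_le_tsum _) h2)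
      (ENNReal.rpow_le_rpow (ENNReal.sum_le_tsum _) (inv_nonneg.2 hp0.le))
  refine (ENNReal.rpow_le_rpow h1 hp0.le).trans_eq ?_
  rw [ENNReal.mul_rpow_of_nonneg _ _ hp0.le, ← ENNReal.rpow_mul, ← ENNReal.rpow_mul,
    inv_mul_cancel₀ hp0.ne', ENNReal.rpow_one, sub_mul, inv_mul_cancel₀ hp0.ne', one_mul]

variable {Ω : Type*}

/-- The sum of the `r`-th powers of the dyadic increments, weighted by their levels. -/
def dyadicSum (T β r : ℝ) (X : ℝ → Ω → ℝ) (ω : Ω) : ℝ≥0∞ :=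
  ∑' n : ℕ, ∑ i ∈ Finset.range (2 ^ n),
    (‖X (dyadicNode T n (i + 1)) ω - X (dyadicNode T n i) ω‖ₑ
      / ENNReal.ofReal (((1 / 2 : ℝ) ^ β) ^ n)) ^ r

theorem abs_sub_le_of_dyadicSum {T β r : ℝ} (hr : 0 < r) {X : ℝ → Ω → ℝ} {ω : Ω}
    (hω : dyadicSum T β r X ω < ⊤) {n i : ℕ} (hi : i < 2 ^ n) :
    |X (dyadicNode T n (i + 1)) ω - X (dyadicNode T n i) ω|
      ≤ (dyadicSum T β r X ω).toReal ^ (1 / r) * ((1 / 2 : ℝ) ^ β) ^ n := by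
  have hρ : 0 < ((1 / 2 : ℝ) ^ β) ^ n := by positivity
  have h1 : (‖X (dyadicNode T n (i + 1)) ω - X (dyadicNode T n i) ω‖ₑ
      / ENNReal.ofReal (((1 / 2 : ℝ) ^ β) ^ n)) ^ r ≤ dyadicSum T β r X ω := by
    refine le_trans ?_ (ENNReal.le_tsum n)
    exact Finset.single_le_sum (f := fun i => (‖X (dyadicNode T n (i + 1)) ω
      - X (dyadicNode T n i) ω‖ₑ / ENNReal.ofReal (((1 / 2 : ℝ) ^ β) ^ n)) ^ r)
      (fun _ _ => zero_le) (Finset.mem_range.2 hi)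
  rw [← ENNReal.le_rpow_inv_iff hr, ENNReal.div_le_iff (ENNReal.ofReal_pos.2 hρ).ne'
    ENNReal.ofReal_ne_top] at h1
  have h2 := ENNReal.toReal_mono (by finiteness) h1
  rwa [toReal_enorm, Real.norm_eq_abs, ENNReal.toReal_mul, ENNReal.toReal_ofReal hρ.le,
    ← ENNReal.toReal_rpow, ← one_div] at h2

variable [MeasurableSpace Ω] {P : Measure Ω}

theorem measurable_dyadicSum {T β r : ℝ} {X : ℝ → Ω → ℝ} (hX : ∀ t, Measurable (X t)) :
    Measurable (dyadicSum T β r X) := by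
  unfold dyadicSum
  refine Measurable.tsum fun n => Finset.measurable_fun_sum _ fun i _ => ?_
  exact (((hX _).sub (hX _)).enorm.div_const _).pow_const _

/-- A bound for the expectation of `dyadicSum` for a fractional Brownian motion. -/
def dyadicMoment (h T β r : ℝ) : ℝ≥0∞ :=
  ENNReal.ofReal (T ^ (h * r)) * gaussianMoment r
    * ∑' n : ℕ, ENNReal.ofReal ((1 / 2 : ℝ) ^ ((h - β) * r - 1)) ^ n

theorem dyadicMoment_lt_top {h T β r : ℝ} (hr : 0 < r) (hβ : 1 < (h - β) * r) :
    dyadicMoment h T β r < ⊤ := by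
  have h1 : ENNReal.ofReal ((1 / 2 : ℝ) ^ ((h - β) * r - 1)) < 1 := by
    rw [← ENNReal.ofReal_one]
    exact (ENNReal.ofReal_lt_ofReal_iff one_pos).2 (half_rpow_lt_one (by linarith))
  unfold dyadicMoment
  rw [ENNReal.tsum_geometric]
  refine ENNReal.mul_lt_top (ENNReal.mul_lt_top ENNReal.ofReal_lt_top (gaussianMoment_lt_top hr)) ?_
  exact ENNReal.inv_lt_top.2 (tsub_pos_of_lt h1)

/-- Level `n` has `2 ^ n` increments of length `T / 2 ^ n`, each weighted by the target modulus. The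
resulting sequence is geometric, with ratio below one when `(h - β) * r > 1`. -/
theorem dyadic_level_eq {h T β r : ℝ} (hT : 0 < T) (n : ℕ) :
    (2 : ℝ) ^ n * (T / 2 ^ n) ^ (h * r) / (((1 / 2 : ℝ) ^ β) ^ n) ^ r
      = T ^ (h * r) * ((1 / 2 : ℝ) ^ ((h - β) * r - 1)) ^ n := by
  have h2 : (0 : ℝ) < 1 / 2 := by norm_num
  have h3 : T / 2 ^ n = T * (1 / 2) ^ (n : ℝ) := by
    rw [Real.rpow_natCast, one_div, inv_pow, div_eq_mul_inv]
  have h4 : (2 : ℝ) ^ n = (1 / 2) ^ (-(n : ℝ)) := by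
    rw [Real.rpow_neg h2.le, Real.rpow_natCast, one_div, inv_pow, inv_inv]
  rw [h3, h4, Real.mul_rpow hT.le (by positivity), ← Real.rpow_mul h2.le, ← Real.rpow_natCast,
    ← Real.rpow_mul h2.le, ← Real.rpow_mul h2.le, ← Real.rpow_natCast, ← Real.rpow_mul h2.le,
    mul_left_comm, ← Real.rpow_add h2, mul_div_assoc, ← Real.rpow_sub h2]
  congr 2
  ring

theorem lintegral_dyadicSum_le {h T β r : ℝ} (hT : 0 < T) (hr : 0 < r) {X : ℝ → Ω → ℝ}
    (hX : ∀ t, Measurable (X t))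
    (hm : ∀ s, 0 ≤ s → ∀ t, 0 ≤ t → ∫⁻ ω, ‖X t ω - X s ω‖ₑ ^ r ∂P
      = ENNReal.ofReal (|t - s| ^ (h * r)) * gaussianMoment r) :
    ∫⁻ ω, dyadicSum T β r X ω ∂P ≤ dyadicMoment h T β r := by
  unfold dyadicSum dyadicMoment
  have hmeas : ∀ n i, Measurable fun ω => (‖X (dyadicNode T n (i + 1)) ω
      - X (dyadicNode T n i) ω‖ₑ / ENNReal.ofReal (((1 / 2 : ℝ) ^ β) ^ n)) ^ r := fun n i =>
    (((hX _).sub (hX _)).enorm.div_const _).pow_const _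
  rw [lintegral_tsum fun n => (Finset.measurable_fun_sum _ fun i _ => hmeas n i).aemeasurable,
    ← ENNReal.tsum_mul_left]
  refine ENNReal.tsum_le_tsum fun n => ?_
  have hρ : 0 < ((1 / 2 : ℝ) ^ β) ^ n := by positivity
  rw [lintegral_finsetSum _ fun i _ => hmeas n i]
  have hi : ∀ i ∈ Finset.range (2 ^ n), ∫⁻ ω, (‖X (dyadicNode T n (i + 1)) ω
      - X (dyadicNode T n i) ω‖ₑ / ENNReal.ofReal (((1 / 2 : ℝ) ^ β) ^ n)) ^ r ∂P
      = ENNReal.ofReal ((T / 2 ^ n) ^ (h * r) / (((1 / 2 : ℝ) ^ β) ^ n) ^ r)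
        * gaussianMoment r := by
    intro i _
    have hnode : ∀ j : ℕ, 0 ≤ dyadicNode T n j := fun j => by
      unfold dyadicNode
      positivity
    have hd : |dyadicNode T n (i + 1) - dyadicNode T n i| = T / 2 ^ n := by
      rw [show dyadicNode T n (i + 1) - dyadicNode T n i = T / 2 ^ n by
        unfold dyadicNode
        push_cast
        ring]
      exact abs_of_pos (by positivity)
    have hmul : ∀ x : ℝ≥0∞, (x / ENNReal.ofReal (((1 / 2 : ℝ) ^ β) ^ n)) ^ r
        = x ^ r * (ENNReal.ofReal ((((1 / 2 : ℝ) ^ β) ^ n) ^ r))⁻¹ := fun x => by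
      rw [ENNReal.div_rpow_of_nonneg _ _ hr.le, ENNReal.ofReal_rpow_of_pos hρ, div_eq_mul_inv]
    have hmeas' : Measurable fun ω =>
        ‖X (dyadicNode T n (i + 1)) ω - X (dyadicNode T n i) ω‖ₑ ^ r :=
      ((hX _).sub (hX _)).enorm.pow_const _
    simp only [hmul]
    rw [lintegral_mul_const _ hmeas', hm _ (hnode _) _ (hnode _), hd,
      ENNReal.ofReal_div_of_pos (by positivity)]
    simp only [ENNReal.div_eq_inv_mul]
    ring
  rw [Finset.sum_congr rfl hi, Finset.sum_const, Finset.card_range, nsmul_eq_mul]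
  have h2 : (((2 ^ n : ℕ) : ℕ) : ℝ≥0∞) = ENNReal.ofReal ((2 : ℝ) ^ n) := by
    rw [ENNReal.ofReal_pow (by norm_num)]
    simp
  rw [h2, ← mul_assoc, ← ENNReal.ofReal_mul (by positivity), ← mul_div_assoc,
    dyadic_level_eq hT, ENNReal.ofReal_mul (by positivity), ENNReal.ofReal_pow (by positivity)]
  exact le_of_eq (by ring)

variable {V : Type*} [NormedAddCommGroup V] [InnerProductSpace ℝ V]

/-- The noise is driven, almost surely, by Hölder continuous paths whose constants have moments
of all orders. -/
theorem exists_driver [IsProbabilityMeasure P] {σ : ℕ → ℝ} {e : ℕ → V}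
    (he : Pairwise fun i j => inner ℝ (e i) (e j) = 0) (hσ : Summable fun k => σ k ^ 2 * ‖e k‖ ^ 2)
    {h β T q : ℝ} (hβ : 0 < β) (hβh : β < h) (hT : 0 < T) (hq : 2 ≤ q)
    {B : ℕ → ℝ≥0 → Ω → ℝ} (hB : ∀ k, IsFBM h (B k) P) :
    ∃ (b : ℕ → ℝ → Ω → ℝ) (M : ℕ → Ω → ℝ), (∀ k t, Measurable (b k t)) ∧
      (∀ ω, IsDriver β σ e (fun k => M k ω) fun k t => b k t ω) ∧
      (∀ᵐ ω ∂P, ∀ k, ∀ t ∈ Icc 0 T, B k t.toNNReal ω = b k t ω) ∧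
      ∫⁻ ω, ENNReal.ofReal √(seriesSize σ e fun k => M k ω) ^ q ∂P < ⊤ := by
  classical
  have hh : 0 < h := hβ.trans hβh
  -- The moment must be high enough for the dyadic sums to converge and at least `q`, so that it
  -- controls the `q`-th moment.
  obtain ⟨r, hqr, hr⟩ : ∃ r, q ≤ r ∧ 1 < (h - β) * r := by
    refine ⟨max q (2 / (h - β)), le_max_left _ _, ?_⟩
    have h1 : 0 < h - β := sub_pos.2 hβh
    calc (1 : ℝ) < (h - β) * (2 / (h - β)) := by rw [mul_div_cancel₀ _ h1.ne']; norm_num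
      _ ≤ _ := by gcongr; exact le_max_right _ _
  have hr2 : 2 ≤ r := hq.trans hqr
  have hr0 : 0 < r := by linarith
  set c := dyadicConst β T with hc
  have hc0 : 0 ≤ c := dyadicConst_nonneg hβ hT
  have hBm : ∀ k t, AEMeasurable (B k t) P := fun k t => (hB k).gaussian.aemeasurable t
  let X : ℕ → ℝ → Ω → ℝ := fun k t => (hBm k t.toNNReal).mk
  have hXm : ∀ k t, Measurable (X k t) := fun k t => (hBm k t.toNNReal).measurable_mk
  have hXB : ∀ k t, B k t.toNNReal =ᵐ[P] X k t := fun k t => (hBm k t.toNNReal).ae_eq_mk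
  let D : ℕ → Ω → ℝ≥0∞ := fun k => dyadicSum T β r (X k)
  have hDm : ∀ k, Measurable (D k) := fun k => measurable_dyadicSum (hXm k)
  have hD : ∀ k, ∫⁻ ω, D k ω ∂P ≤ dyadicMoment h T β r := by
    refine fun k => lintegral_dyadicSum_le hT hr0 (hXm k) fun s hs t ht => ?_
    have h1 := (hB k).lintegral_sub_rpow hh hr0 s.toNNReal t.toNNReal
    rw [Real.coe_toNNReal t ht, Real.coe_toNNReal s hs] at h1
    rw [← h1]
    refine lintegral_congr_ae ?_
    filter_upwards [hXB k s, hXB k t] with ω h2 h3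
    rw [h2, h3]
  have hmom := dyadicMoment_lt_top (T := T) hr0 hr
  set w : ℕ → ℝ≥0∞ := fun k => ENNReal.ofReal (σ k ^ 2 * ‖e k‖ ^ 2) with hw
  have hA : ∑' k, w k ≠ ⊤ := by
    rw [hw, ← ENNReal.ofReal_tsum_of_nonneg (fun k => by positivity) hσ]
    exact ENNReal.ofReal_ne_top
  -- On the good event `seriesSize` equals `c ^ 2 * S`. Jensen with exponent `r / 2 ≥ 1` reduces the
  -- moment of `S` to the first moments of the `D k`, bounded uniformly in `k`.
  let S : Ω → ℝ≥0∞ := fun ω => ∑' k, w k * D k ω ^ (2 / r)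
  have hSm : Measurable S :=
    Measurable.tsum fun k => ((hDm k).pow_const _).const_mul _
  have hS : ∫⁻ ω, S ω ^ (r / 2) ∂P < ⊤ := by
    have h1 : ∀ ω, S ω ^ (r / 2) ≤ (∑' k, w k) ^ (r / 2 - 1) * ∑' k, w k * D k ω := by
      intro ω
      refine (tsum_mul_rpow_le (by linarith)).trans_eq ?_
      have h2 : 2 / r * (r / 2) = 1 := by field_simp
      simp only [← ENNReal.rpow_mul, h2, ENNReal.rpow_one]
    have hm : ∀ k, Measurable fun ω => w k * D k ω := fun k => (hDm k).const_mul _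
    refine (lintegral_mono h1).trans_lt ?_
    rw [lintegral_const_mul _ (Measurable.tsum hm),
      lintegral_tsum fun k => (hm k).aemeasurable]
    refine ENNReal.mul_lt_top (ENNReal.rpow_lt_top_of_nonneg (by linarith) hA) ?_
    calc ∑' k, ∫⁻ ω, w k * D k ω ∂P ≤ ∑' k, w k * dyadicMoment h T β r := by
          refine ENNReal.tsum_le_tsum fun k => ?_
          rw [lintegral_const_mul _ (hDm k)]
          exact mul_le_mul_right (hD k) _
      _ = (∑' k, w k) * dyadicMoment h T β r := ENNReal.tsum_mul_right
      _ < ⊤ := ENNReal.mul_lt_top hA.lt_top hmom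
  have hgood : ∀ᵐ ω ∂P, (∀ k, Continuous fun t => B k t ω) ∧ (∀ k, B k 0 ω = 0) ∧
      (∀ k n i, B k (dyadicNode T n i).toNNReal ω = X k (dyadicNode T n i) ω) ∧
      (∀ k, D k ω < ⊤) ∧ S ω < ⊤ := by
    have hS' : ∀ᵐ ω ∂P, S ω < ⊤ := by
      filter_upwards [ae_lt_top (hSm.pow_const _) hS.ne] with ω hω
      exact (ENNReal.rpow_lt_top_iff_of_pos (by linarith)).1 hω
    filter_upwards [ae_all_iff.2 fun k => (hB k).continuous, ae_all_iff.2 fun k => (hB k).ae_zero hh,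
      ae_all_iff.2 fun k => ae_all_iff.2 fun n => ae_all_iff.2 fun i => hXB k (dyadicNode T n i),
      ae_all_iff.2 fun k => ae_lt_top (hDm k) ((hD k).trans_lt hmom).ne, hS'] with ω h1 h2 h3 h4 h5
    exact ⟨h1, h2, h3, h4, h5⟩
  -- Paths and constants are set to zero off a measurable set of full measure, so that the driver
  -- properties hold for every `ω`.
  obtain ⟨G, hGae, hGm, hG⟩ := hgood.exists_measurable_mem
  -- Freezing the path outside `[0, T]` gives a Hölder bound on the whole line and, as the motion
  -- starts at `0`, a path that vanishes before time `0`.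
  let clamp : ℝ → ℝ := fun t => max 0 (min t T)
  have hclamp : ∀ t, clamp t ∈ Icc 0 T := fun t =>
    ⟨le_max_left _ _, max_le hT.le (min_le_right _ _)⟩
  let b : ℕ → ℝ → Ω → ℝ := fun k t => G.indicator fun ω => B k (clamp t).toNNReal ω
  let M : ℕ → Ω → ℝ := fun k => G.indicator fun ω => c * (D k ω).toReal ^ (1 / r)
  have hsize : ∀ ω ∈ G, ∀ k, σ k ^ 2 * ‖e k‖ ^ 2 * M k ω ^ 2
      = c ^ 2 * (w k * D k ω ^ (2 / r)).toReal := by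
    intro ω hω k
    have h1 : ((D k ω).toReal ^ (1 / r)) ^ 2 = (D k ω).toReal ^ (2 / r) := by
      rw [← Real.rpow_natCast, ← Real.rpow_mul ENNReal.toReal_nonneg]
      congr 1
      push_cast
      ring
    simp only [M, indicator_of_mem hω]
    rw [ENNReal.toReal_mul, hw, ENNReal.toReal_ofReal (by positivity), ← ENNReal.toReal_rpow,
      mul_pow, h1]
    ring
  have hcont : ∀ ω ∈ G, ∀ k, Continuous fun t : ℝ => B k t.toNNReal ω := fun ω hω k =>
    ((hG ω hω).1 k).comp continuous_real_toNNReal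
  refine ⟨b, M, fun k t => ?_, fun ω => ?_, ?_, ?_⟩
  -- `B k t` is only almost everywhere measurable. On `G` it agrees with the measurable versions at
  -- dyadic points, and path continuity recovers the other times as limits.
  · refine measurable_of_tendsto_metrizable (f := fun n => G.indicator
      (X k (dyadicNode T n (dyadicIndex T n (clamp t))))) (fun n => (hXm _ _).indicator hGm)
      (tendsto_pi_nhds.2 fun ω => ?_)
    by_cases hω : ω ∈ G
    · simp only [b, indicator_of_mem hω, ← (hG ω hω).2.2.1]
      exact ((hcont ω hω k).tendsto _).comp (tendsto_dyadicNode hT (hclamp t))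
    · simp only [b, indicator_of_notMem hω]
      exact tendsto_const_nhds
  · by_cases hω : ω ∈ G
    · refine ⟨fun k s t => ?_, fun k t ht => ?_, ?_, he⟩
      · have h1 := abs_sub_le_of_dyadic hT hβ (Real.rpow_nonneg ENNReal.toReal_nonneg (1 / r))
          (hcont ω hω k).continuousOn (fun n i hi => by
            simp only [(hG ω hω).2.2.1]
            exact abs_sub_le_of_dyadicSum hr0 ((hG ω hω).2.2.2.1 k) hi) (hclamp s) (hclamp t)
        simp only [b, M, indicator_of_mem hω]
        refine h1.trans (mul_le_mul_of_nonneg_left ?_ (by positivity))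
        refine Real.rpow_le_rpow (abs_nonneg _) ?_ hβ.le
        refine (abs_max_sub_max_le_max 0 (min t T) 0 (min s T)).trans ?_
        simp only [sub_self, abs_zero]
        refine max_le (abs_nonneg _) ((abs_min_sub_min_le_max t T s T).trans ?_)
        simp
      · have h1 : clamp t = 0 := max_eq_left ((min_le_left _ _).trans ht)
        simp only [b, indicator_of_mem hω, h1, Real.toNNReal_zero]
        exact (hG ω hω).2.1 k
      · simp only [hsize ω hω]
        exact (ENNReal.summable_toReal (hG ω hω).2.2.2.2.ne).mul_left _
    · refine ⟨fun k s t => ?_, fun k t ht => ?_, ?_, he⟩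
      · simp [b, M, indicator_of_notMem hω]
      · simp [b, indicator_of_notMem hω]
      · simp [M, indicator_of_notMem hω]
  · filter_upwards [hGae] with ω hω k t ht
    have h1 : clamp t = t := by simp [clamp, ht.1, ht.2]
    simp only [b, indicator_of_mem hω, h1]
  -- Uses `x ^ q ≤ 1 + x ^ r` for `q ≤ r`.
  · have hbound : ∀ᵐ ω ∂P, ENNReal.ofReal √(seriesSize σ e fun k => M k ω) ^ q
        ≤ 1 + ENNReal.ofReal c ^ r * S ω ^ (r / 2) := by
      filter_upwards [hGae] with ω hω
      have hfin := (hG ω hω).2.2.2.2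
      have h1 : seriesSize σ e (fun k => M k ω) = c ^ 2 * (S ω).toReal := by
        unfold seriesSize
        simp only [hsize ω hω]
        rw [tsum_mul_left, ← ENNReal.tsum_toReal_eq]
        exact fun k => ENNReal.ne_top_of_tsum_ne_top hfin.ne k
      have h2 : ENNReal.ofReal √(seriesSize σ e fun k => M k ω)
          = ENNReal.ofReal c * S ω ^ (1 / 2 : ℝ) := by
        rw [h1, Real.sqrt_mul (sq_nonneg _), Real.sqrt_sq hc0, ENNReal.ofReal_mul hc0,
          Real.sqrt_eq_rpow, ENNReal.toReal_rpow, ENNReal.ofReal_toReal]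
        exact (ENNReal.rpow_lt_top_of_nonneg (by norm_num) hfin.ne).ne
      have h3 : ENNReal.ofReal c ^ r * S ω ^ (r / 2)
          = ENNReal.ofReal √(seriesSize σ e fun k => M k ω) ^ r := by
        rw [h2, ENNReal.mul_rpow_of_nonneg _ _ hr0.le, ← ENNReal.rpow_mul]
        congr 2
        ring
      rw [h3]
      rcases le_total (ENNReal.ofReal √(seriesSize σ e fun k => M k ω)) 1 with h4 | h4
      · exact (ENNReal.rpow_le_one h4 (by linarith)).trans le_self_add
      · exact (ENNReal.rpow_le_rpow_of_exponent_le h4 hqr).trans le_add_self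
    refine (lintegral_mono_ae hbound).trans_lt ?_
    rw [lintegral_add_left measurable_const, lintegral_const_mul _ (hSm.pow_const _),
      lintegral_const, measure_univ, one_mul]
    exact ENNReal.add_lt_top.2 ⟨ENNReal.one_lt_top, ENNReal.mul_lt_top
      (ENNReal.rpow_lt_top_of_nonneg hr0.le ENNReal.ofReal_ne_top) hS⟩

end Driver

/-! ### Processes with Hölder continuous paths -/

section LqPVar

variable {V : Type*} [NormedAddCommGroup V] {Ω : Type*} [MeasurableSpace Ω] {P : Measure Ω}
  {p q T a β : ℝ} {X Y : ℝ → Ω → V} {R : Ω → ℝ}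

theorem lqPVar_congr (h : ∀ᵐ ω ∂P, EqOn (fun t => X t ω) (fun t => Y t ω) (Icc 0 T)) :
    lqPVar q p T X P = lqPVar q p T Y P := by
  unfold lqPVar
  congr 1
  refine lintegral_congr_ae ?_
  filter_upwards [h] with ω hω
  rw [pVar_congr hω]

theorem pVar_rpow_le (hp : 0 < p) (hq : 0 < q) (hT : 0 ≤ T) (ha : 0 ≤ a) {f : ℝ → V} {r : ℝ}
    (hr : 0 ≤ r)
    (hf : ∀ s ∈ Icc 0 T, ∀ t ∈ Icc 0 T, ‖f t - f s‖ ≤ a * r * |t - s| ^ (1 / p)) :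
    pVar p T f ^ q ≤ ENNReal.ofReal (a * T ^ (1 / p)) ^ q * ENNReal.ofReal r ^ q := by
  rw [← ENNReal.mul_rpow_of_nonneg _ _ hq.le, ← ENNReal.ofReal_mul (by positivity)]
  refine ENNReal.rpow_le_rpow ?_ hq.le
  refine (pVar_le_of_holder hp hT (by positivity) hf).trans_eq ?_
  congr 1
  ring

theorem lqPVar_le (hp : 0 < p) (hq : 0 < q) (hT : 0 ≤ T) (ha : 0 ≤ a) (hR : ∀ ω, 0 ≤ R ω)
    (hX : ∀ᵐ ω ∂P, ∀ s ∈ Icc 0 T, ∀ t ∈ Icc 0 T,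
      ‖X t ω - X s ω‖ ≤ a * R ω * |t - s| ^ (1 / p)) :
    lqPVar q p T X P
      ≤ ENNReal.ofReal (a * T ^ (1 / p)) * (∫⁻ ω, ENNReal.ofReal (R ω) ^ q ∂P) ^ (1 / q) := by
  have h1 : ∫⁻ ω, pVar p T (fun t => X t ω) ^ q ∂P
      ≤ ENNReal.ofReal (a * T ^ (1 / p)) ^ q * ∫⁻ ω, ENNReal.ofReal (R ω) ^ q ∂P := by
    rw [← lintegral_const_mul' _ _ (ENNReal.rpow_lt_top_of_nonneg hq.le ENNReal.ofReal_ne_top).ne]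
    refine lintegral_mono_ae ?_
    filter_upwards [hX] with ω hω
    exact pVar_rpow_le hp hq hT ha (hR ω) hω
  unfold lqPVar
  refine (ENNReal.rpow_le_rpow h1 (by positivity)).trans_eq ?_
  rw [ENNReal.mul_rpow_of_nonneg _ _ (by positivity), ← ENNReal.rpow_mul,
    mul_one_div_cancel hq.ne', ENNReal.rpow_one]

theorem rpow_abs_sub_le {κ s t : ℝ} (hκ : 0 < κ) (hκβ : κ ≤ β) (hs : s ∈ Icc 0 T)
    (ht : t ∈ Icc 0 T) : |t - s| ^ β ≤ T ^ (β - κ) * |t - s| ^ κ := by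
  have h1 : |t - s| ≤ T := abs_sub_le_iff.2 ⟨by linarith [ht.2, hs.1], by linarith [hs.2, ht.1]⟩
  rw [show |t - s| ^ β = |t - s| ^ (β - κ) * |t - s| ^ κ by
    rw [← Real.rpow_add_of_nonneg (abs_nonneg _) (sub_nonneg.2 hκβ) hκ.le]
    congr 1
    ring]
  gcongr

variable [NormedSpace ℝ V]

theorem MemLqPVar.congr (hX : MemLqPVar q p T X P)
    (h : ∀ᵐ ω ∂P, EqOn (fun t => X t ω) (fun t => Y t ω) (Icc 0 T)) : MemLqPVar q p T Y P := by
  obtain ⟨S, hS, hSX⟩ := hX.stronglyMeasurable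
  refine ⟨?_, ⟨S, hS, ?_⟩, ?_⟩
  · filter_upwards [hX.mem, h] with ω h1 h2 η hη
    obtain ⟨g, hg, hg'⟩ := h1 η hη
    refine ⟨g, hg, ?_⟩
    rwa [pVar_congr (g := (fun t => X t ω) - g) fun t ht => by simp [(h2 ht).symm]]
  · filter_upwards [hSX, h] with ω h1 h2
    refine h1.congr fun n => pVar_congr fun t ht => ?_
    have := h2 ht
    simp only at this
    simp [this]
  · rw [← lqPVar_congr h]
    exact hX.norm_lt_top

/-- The exponent `β > 1 / p` is used in full for approximation by smooth and simple paths; for the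
norm it is lowered to `1 / p` at the cost of a power of `T`. -/
theorem memLqPVar_of_holder [IsFiniteMeasure P] (hT : 0 < T) (hp : 1 < p) (hβ : 1 / p < β)
    (hq : 0 < q) (ha : 0 ≤ a) (hX : ∀ t, AEStronglyMeasurable (X t) P) (hR : ∀ ω, 0 ≤ R ω)
    (hXR : ∀ᵐ ω ∂P, ∀ s ∈ Icc 0 T, ∀ t ∈ Icc 0 T, ‖X t ω - X s ω‖ ≤ a * R ω * |t - s| ^ β)
    (hRq : ∫⁻ ω, ENNReal.ofReal (R ω) ^ q ∂P < ⊤) : MemLqPVar q p T X P := by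
  have hp0 : 0 < p := zero_lt_one.trans hp
  refine ⟨?_, exists_simpleFunc_tendsto_pVar hT hp hβ hX (fun ω => mul_nonneg ha (hR ω)) hXR, ?_⟩
  · filter_upwards [hXR] with ω hω
    exact mem_pVarSpace_of_holder hT (mul_nonneg ha (hR ω)) hp hβ hω
  · refine (lqPVar_le (a := a * T ^ (β - 1 / p)) hp0 hq hT.le (by positivity) hR ?_).trans_lt
      (ENNReal.mul_lt_top ENNReal.ofReal_lt_top
        (ENNReal.rpow_lt_top_of_nonneg (by positivity) hRq.ne))
    filter_upwards [hXR] with ω hω s hs t ht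
    refine (hω s hs t ht).trans ?_
    have := hR ω
    calc a * R ω * |t - s| ^ β ≤ a * R ω * (T ^ (β - 1 / p) * |t - s| ^ (1 / p)) := by
          gcongr
          exact rpow_abs_sub_le (by positivity) hβ.le hs ht
      _ = _ := by ring

end LqPVar

/-- Partial sums are measurable scalars times fixed vectors, hence strongly measurable without
separability of `V`, and so is their pointwise limit. -/
theorem aestronglyMeasurable_smallScale {V : Type*} [NormedAddCommGroup V] [InnerProductSpace ℝ V]
    [CompleteSpace V] {Ω : Type*} [MeasurableSpace Ω] {P : Measure Ω} {β m : ℝ} {σ μ : ℕ → ℝ}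
    {e : ℕ → V} {M : ℕ → Ω → ℝ} {b : ℕ → ℝ → Ω → ℝ} (hbm : ∀ k t, Measurable (b k t))
    (hb : ∀ ω, IsDriver β σ e (fun k => M k ω) fun k t => b k t ω) (hβ : 0 < β) (hm : 0 < m)
    (hμ : ∀ k, m ≤ μ k) {ε : ℝ} (hε : 0 ≤ ε) (t : ℝ) :
    AEStronglyMeasurable (fun ω => smallScale σ e μ (fun k t => b k t ω) ε t) P := by
  have hc : ∀ k, Measurable fun ω => σ k / μ k * expMean (ε / μ k) (fun t => b k t ω) t :=
    fun k => (measurable_expMean (hbm k)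
      (fun ω => ((hb ω).holder k).continuous hβ) _ _).const_mul _
  refine aestronglyMeasurable_of_tendsto_ae atTop
    (f := fun (n : ℕ) ω => ∑ k ∈ Finset.range n,
      (σ k / μ k * expMean (ε / μ k) (fun t => b k t ω) t) • e k) (fun n => ?_)
    (Eventually.of_forall fun ω => ?_)
  · exact Finset.aestronglyMeasurable_fun_sum _ fun k _ =>
      ((hc k).stronglyMeasurable.smul_const _).aestronglyMeasurable
  · exact ((hb ω).summable_smallScale hβ hm hμ hε t).hasSum.tendsto_sum_nat

end FastSlow

end

/-! ### Assembly of the pathwise estimates and the moment bound. -/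

theorem proposition4p1 {d : ℕ} (hd : d = 2 ∨ d = 3) {ξ : ℝ} (hξ : (d : ℝ) / 2 + 2 < ξ)
    {Ω : Type*} [MeasurableSpace Ω] {P : Measure Ω} [IsProbabilityMeasure P]
    {T : ℝ} (hT : 0 < T) {h : ℝ} (hh : 1 / 2 < h) (hh1 : h < 1)
    {σ : ℕ → ℝ} {e : ℕ → FastSlow.Sobolev d ξ} (he : FastSlow.IsNoiseBasis σ e)
    {B : ℕ → ℝ≥0 → Ω → ℝ} (hB : ∀ k, FastSlow.IsFBM h (B k) P)
    (hind : iIndepFun (fun k ω t => B k t ω) P)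
    {C : FastSlow.HSpace d →ₗ.[ℝ] FastSlow.HSpace d} {lam : ℕ → ℝ} {γ : ℝ}
    (hC : FastSlow.IsFriction C e lam γ)
    {α : ℝ} (hα : α = 1) {p q : ℝ} (hp : 1 / h < p) (hq : 2 ≤ q) :
    (∃ w : ℝ → ℝ → Ω → FastSlow.Sobolev d ξ, ∀ᵐ ω ∂P, ∀ ε ∈ Ioo (0 : ℝ) 1,
      FastSlow.IsOUPath C h ε T (fun t => FastSlow.noise σ e B t ω) (fun t => w ε t ω)) ∧
    ∀ w : ℝ → ℝ → Ω → FastSlow.Sobolev d ξ,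
      (∀ ε ∈ Ioo (0 : ℝ) 1, ∀ᵐ ω ∂P,
        FastSlow.IsOUPath C h ε T (fun t => FastSlow.noise σ e B t ω) (fun t => w ε t ω)) →
      (∀ ε ∈ Ioo (0 : ℝ) 1,
        FastSlow.MemLqPVar q p T (FastSlow.integratedOU α h ε (w ε)) P) ∧
      (∃ Z : ℝ → Ω → FastSlow.Sobolev d ξ,
        (∀ᵐ ω ∂P, ∀ t ∈ Icc 0 T, ∃ x : C.domain,
          (x : FastSlow.HSpace d) = FastSlow.Sobolev.incl (Z t ω) ∧
          -C x = FastSlow.Sobolev.incl (FastSlow.noise σ e B t ω)) ∧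
        FastSlow.MemLqPVar q p T Z P ∧
        Tendsto (fun ε => FastSlow.lqPVar q p T
          (fun t ω => FastSlow.integratedOU α h ε (w ε) t ω - Z t ω) P) (𝓝[>] 0) (𝓝 0)) ∧
      (∃ K θ : ℝ, 0 < θ ∧ θ ≤ 1 ∧ ∀ ε ∈ Ioo (0 : ℝ) 1, ∀ δ ∈ Ioo (0 : ℝ) 1,
        FastSlow.lqPVar q p T (fun t ω => FastSlow.integratedOU α h ε (w ε) t ω
          - FastSlow.integratedOU α h δ (w δ) t ω) P ≤ ENNReal.ofReal (K * |ε - δ| ^ θ)) ∧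
      ((∀ᵐ ω ∂P, ∀ ε ∈ Ioo (0 : ℝ) 1,
        FastSlow.IsOUPath C h ε T (fun t => FastSlow.noise σ e B t ω) (fun t => w ε t ω)) →
        AEMeasurable (fun ω => ⨆ ε ∈ Ioo (0 : ℝ) 1,
          FastSlow.pVar p T (fun t => FastSlow.integratedOU α h ε (w ε) t ω) ^ q) P ∧
        ∫⁻ ω, ⨆ ε ∈ Ioo (0 : ℝ) 1,
          FastSlow.pVar p T (fun t => FastSlow.integratedOU α h ε (w ε) t ω) ^ q ∂P < ⊤) := by
  subst hα
  have hh0 : 0 < h := by linarith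
  have hp0 : 0 < p := (one_div_pos.2 hh0).trans hp
  have hph : 1 / p < h := (one_div_lt hh0 hp0).1 hp
  have hp1 : 1 < p := ((one_lt_div hh0).2 hh1).trans hp
  have hq0 : 0 < q := by linarith
  have hξ0 : 0 ≤ ξ := by
    have : (0 : ℝ) ≤ d := d.cast_nonneg
    linarith
  have : CompleteSpace (FastSlow.Sobolev d ξ) := FastSlow.Sobolev.completeSpace d hξ0
  have hκ : 0 < 1 / p := one_div_pos.2 hp0
  obtain ⟨β, hpβ, hβh⟩ := exists_between hph
  have hβ : 0 < β := hκ.trans hpβ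
  obtain ⟨b, M, hbm, hb, hbB, hbq⟩ :=
    FastSlow.exists_driver he.orthogonal he.summable hβ hβh hT hq hB
  set R : Ω → ℝ := fun ω => √(FastSlow.seriesSize σ e fun k => M k ω) with hR
  have hR0 : ∀ ω, 0 ≤ R ω := fun ω => Real.sqrt_nonneg _
  set m : ℝ := -lam 0
  have hm : 0 < m := neg_pos.2 hC.lam_neg
  have hμ : ∀ k, m ≤ -lam k := hC.neg_lam_ge
  -- The explicit representation, defined on all of `Ω`; `Y 0` will be the limit `(-C)⁻¹ W`.
  let Y : ℝ → ℝ → Ω → FastSlow.Sobolev d ξ := fun ε t ω =>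
    FastSlow.smallScale σ e (fun k => -lam k) (fun k t => b k t ω) ε t
  have hW : ∀ᵐ ω ∂P, ∀ t ∈ Icc 0 T,
      FastSlow.noise σ e B t ω = ∑' k, (σ k * b k t ω) • e k := by
    filter_upwards [hbB] with ω hω t ht
    simp only [FastSlow.noise, hω _ t ht]
  have hYm : ∀ ε, 0 ≤ ε → ∀ t, AEStronglyMeasurable (Y ε t) P := fun ε hε t =>
    FastSlow.aestronglyMeasurable_smallScale hbm hb hβ hm hμ hε t
  have hYh : ∀ ε, 0 ≤ ε → ∀ ω, ∀ s ∈ Icc 0 T, ∀ t ∈ Icc 0 T,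
      ‖Y ε t ω - Y ε s ω‖ ≤ m⁻¹ * R ω * |t - s| ^ β := fun ε hε ω s _ t _ =>
    (hb ω).norm_smallScale_sub_le hβ hm hμ hε s t
  have hYmem : ∀ ε, 0 ≤ ε → FastSlow.MemLqPVar q p T (Y ε) P := fun ε hε =>
    FastSlow.memLqPVar_of_holder hT hp1 hpβ hq0 (inv_nonneg.2 hm.le) (hYm ε hε) hR0
      (Eventually.of_forall (hYh ε hε)) hbq
  set J : ℝ≥0∞ := (∫⁻ ω, ENNReal.ofReal (R ω) ^ q ∂P) ^ (1 / q) with hJ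
  have hJtop : J ≠ ⊤ := (ENNReal.rpow_lt_top_of_nonneg (by positivity) hbq.ne).ne
  set θ : ℝ := β - 1 / p with hθdef
  have hθ : 0 < θ := sub_pos.2 hpβ
  have hΓ : 0 < Real.Gamma (β + 1) := Real.Gamma_pos_of_pos (by linarith)
  set K : ℝ := 2 * (1 + Real.Gamma (β + 1)) / m ^ θ / m * T ^ (1 / p) * J.toReal with hK
  -- Zero is allowed as a scale: `δ = 0` yields the convergence, and two positive scales yield the
  -- Hölder continuity in `ε`.
  have hdiff : ∀ ε, 0 ≤ ε → ∀ δ, 0 ≤ δ →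
      FastSlow.lqPVar q p T (fun t ω => Y ε t ω - Y δ t ω) P
        ≤ ENNReal.ofReal (K * |ε - δ| ^ θ) := by
    intro ε hε δ hδ
    have hle := FastSlow.lqPVar_le (P := P) (X := fun t ω => Y ε t ω - Y δ t ω)
      (a := 2 * (1 + Real.Gamma (β + 1)) * (|ε - δ| / m) ^ θ / m) hp0 hq0 hT.le (by positivity)
      hR0 (Eventually.of_forall fun ω s _ t _ =>
        (hb ω).norm_smallScale_increment_sub_le hκ hpβ hm hμ hε hδ s t)
    refine hle.trans_eq ?_
    rw [← hJ, ← ENNReal.ofReal_toReal hJtop, ← ENNReal.ofReal_mul (by positivity), hK,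
      Real.div_rpow (abs_nonneg _) hm.le]
    congr 1
    ring
  -- The event on which the noise is represented by the driver does not depend on `ε`, so a common
  -- null set for the equations gives the identification for all `ε` at once.
  have hident : ∀ w : ℝ → Ω → FastSlow.Sobolev d ξ, ∀ ω, (∀ t ∈ Icc 0 T,
      FastSlow.noise σ e B t ω = ∑' k, (σ k * b k t ω) • e k) → ∀ ε, 0 < ε →
      FastSlow.IsOUPath C h ε T (fun t => FastSlow.noise σ e B t ω) (fun t => w t ω) →
      EqOn (fun t => FastSlow.integratedOU 1 h ε w t ω) (fun t => Y ε t ω) (Icc 0 T) :=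
    fun w ω hWω ε hε hw t ht => (hb ω).integratedOU_eq hξ0 hC hβ hT hε hWω hw ht
  refine ⟨⟨fun ε t ω => FastSlow.ouSolution σ e lam (fun k t => b k t ω) h ε t, ?_⟩,
    fun w hw => ?_⟩
  · filter_upwards [hW] with ω hω ε hε
    exact (hb ω).isOUPath hξ0 hC hβ hε.1 hω
  have hwY : ∀ ε ∈ Ioo (0 : ℝ) 1, ∀ᵐ ω ∂P,
      EqOn (fun t => FastSlow.integratedOU 1 h ε (w ε) t ω) (fun t => Y ε t ω) (Icc 0 T) := by
    intro ε hε
    filter_upwards [hW, hw ε hε] with ω h1 h2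
    exact hident (w ε) ω h1 ε hε.1 h2
  -- The bound `θ ≤ 1` holds because `θ = β - 1 / p < β < h < 1`.
  refine ⟨fun ε hε => (hYmem ε hε.1.le).congr ?_, ⟨Y 0, ?_, hYmem 0 le_rfl, ?_⟩,
    ⟨K, θ, hθ, by linarith, fun ε hε δ hδ => ?_⟩, fun hall => ?_⟩
  · filter_upwards [hwY ε hε] with ω hω
    exact hω.symm
  · filter_upwards [hW] with ω hω t ht
    obtain ⟨x, hx, hx'⟩ := (LinearPMap.mem_graph_iff C).1
      ((hb ω).smallScale_mem_graph hξ0 hC hβ le_rfl t)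
    refine ⟨x, hx, ?_⟩
    have h0 : FastSlow.fluctuation σ e (fun k => -lam k) (fun k t => b k t ω) 0 t = 0 := by
      simp [FastSlow.fluctuation, FastSlow.expMean_zero]
    simp only at hx'
    rw [hx', hω t ht, h0, map_zero, zero_sub, neg_neg]
  · have hlim : Tendsto (fun ε : ℝ => ENNReal.ofReal (K * |ε - 0| ^ θ)) (𝓝[>] 0) (𝓝 0) := by
      have hc : Continuous fun ε : ℝ => ENNReal.ofReal (K * |ε - 0| ^ θ) :=
        ENNReal.continuous_ofReal.comp (continuous_const.mul
          ((by fun_prop : Continuous fun ε : ℝ => |ε - 0|).rpow_const fun _ => Or.inr hθ.le))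
      have := hc.tendsto 0
      simp only [sub_self, abs_zero, Real.zero_rpow hθ.ne', mul_zero, ENNReal.ofReal_zero] at this
      exact this.mono_left nhdsWithin_le_nhds
    refine tendsto_of_tendsto_of_tendsto_of_le_of_le' tendsto_const_nhds hlim
      (Eventually.of_forall fun _ => zero_le) ?_
    filter_upwards [Ioo_mem_nhdsGT (zero_lt_one' ℝ)] with ε hε
    refine le_of_eq_of_le (FastSlow.lqPVar_congr ?_) (hdiff ε hε.1.le 0 le_rfl)
    filter_upwards [hwY ε hε] with ω hω t ht
    exact congrArg (· - Y 0 t ω) (hω ht)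
  · refine le_of_eq_of_le (FastSlow.lqPVar_congr ?_) (hdiff ε hε.1.le δ hδ.1.le)
    filter_upwards [hwY ε hε, hwY δ hδ] with ω h1 h2 t ht
    exact congrArg₂ (· - ·) (h1 ht) (h2 ht)
  · have hsup : ∀ᵐ ω ∂P, (⨆ ε ∈ Ioo (0 : ℝ) 1,
        FastSlow.pVar p T (fun t => FastSlow.integratedOU 1 h ε (w ε) t ω) ^ q)
        = ⨆ ε : Ioo (0 : ℝ) 1, FastSlow.pVar p T (fun t => Y ε t ω) ^ q := by
      filter_upwards [hW, hall] with ω h1 h2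
      rw [iSup_subtype']
      refine iSup_congr fun ε => ?_
      rw [FastSlow.pVar_congr (hident (w ε) ω h1 ε ε.2.1 (h2 ε ε.2))]
    refine ⟨(FastSlow.aemeasurable_iSup_pVar_rpow hp0 hq0
      (Y := fun ε : Ioo (0 : ℝ) 1 => Y ε) (fun ε => hYm ε ε.2.1.le)
      (Eventually.of_forall fun ω => (hb ω).continuous_smallScale hβ hm hμ
        fun ε hε => hε.1.le)).congr (hsup.mono fun ω hω => hω.symm), ?_⟩
    rw [lintegral_congr_ae hsup]
    -- Lowering the exponent from `β` to `1 / p` costs `T ^ (β - 1 / p)`; the resulting bound does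
    -- not involve `ε`, so the supremum can be taken before integrating.
    set a : ℝ := m⁻¹ * T ^ (β - 1 / p) with ha
    have ha0 : 0 ≤ a := by positivity
    refine lt_of_le_of_lt (lintegral_mono
      (g := fun ω => ENNReal.ofReal (a * T ^ (1 / p)) ^ q * ENNReal.ofReal (R ω) ^ q)
      fun ω => iSup_le fun ε => ?_) ?_
    · refine FastSlow.pVar_rpow_le hp0 hq0 hT.le ha0 (hR0 ω) fun s hs t ht => ?_
      have h2 := hR0 ω
      refine (hYh ε ε.2.1.le ω s hs t ht).trans ?_
      calc m⁻¹ * R ω * |t - s| ^ β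
          ≤ m⁻¹ * R ω * (T ^ (β - 1 / p) * |t - s| ^ (1 / p)) := by
            gcongr
            exact FastSlow.rpow_abs_sub_le hκ hpβ.le hs ht
        _ = _ := by ring
    · have hlt := ENNReal.rpow_lt_top_of_nonneg hq0.le
        (ENNReal.ofReal_ne_top (r := a * T ^ (1 / p)))
      rw [lintegral_const_mul' _ _ hlt.ne]
      exact ENNReal.mul_lt_top hlt hbq
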